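/- **Models.** A canonical linear SEM-ME on a finite set $V=\mathcal Z\cup\mathcal Y$ of underlying variables ($\mathcal Y$ observed, $\mathcal Z$ seen only through noisy measurements) is an acyclic weighted digraph; the weight $c_{ij}\in\mathbb R$ is the coefficient of $V_j$ in the structural equation of $V_i$. A u-leaf is a variable in $\mathcal Z$ without children; all other variables are nu-leaves; u-leaves have no exogenous noise. With $\mathbf C$ (resp. $\mathbf D$) the coefficients among the nu-leaves (resp. from nu-leaves to u-leaves), the mixing matrix $\mathbf W^{ME}$ has the rows $\mathbf D(\mathbf I-\mathbf C)^{-1}$ for the u-leaves and $(\mathbf I-\mathbf C)^{-1}$ for the nu-leaves. A linear SEM-UR has latent roots $H$ and observed variables $X=\mathbf BH+\mathbf AX+N_X$ with $\mathbf A$ acyclic, and mixing matrix $\mathbf W^{UR}=[(\mathbf I-\mathbf A)^{-1}\mathbf B\;\;(\mathbf I-\mathbf A)^{-1}]$. $An$, $De$ do not contain the variable itself. $\mathrm{TE}(\mathcal V,V)$ (resp. $\mathrm{TC}(V,\mathcal V)$) is the vector of total causal effects (sums over directed paths of products of coefficients) of the elements of $\mathcal V$ on $V$ (resp. of $V$ on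 the elements of $\mathcal V$). **SEM-ME faithfulness.** A possible parent of $V_i$ is an ancestor of $V_i$, or a u-leaf $V\ne V_i$ with $Pa(V)\subseteq An(V_i)$. (a) The total effect of a variable on each of its descendants is nonzero. (b1) For each $V_i$, $\mathrm{TE}(An(V_i),V_i)$ is not a linear combination of $k\le|Pa(V_i)|$ of the vectors $\mathrm{TE}(An(V_i),V)$, $V$ a possible parent of $V_i$, except when $k=|Pa(V_i)|$ and every u-leaf $V_l$ among these $k$ satisfies $Pa(V_l)\subseteq Pa(V_i)$. (b2) For each u-leaf $V_i$ and parent $V_j$ of it, $\mathrm{TE}(An(V_i)\setminus\{V_j\},V_i)$ is not a linear combination of $k\le|Pa(V_j)\cup Pa(V_i)|-1$ of the vectors $\mathrm{TE}(An(V_i)\setminus\{V_j\},V)$, $V$ a possible parent of $V_j$, except when $k=|Pa(V_j)\cup Pa(V_i)|-1$ and every u-leaf $V_l$ among these $k$ satisfies $Pa(V_l)\subseteq Pa(V_j)\cup Pa(V_i)$. **SEM-UR faithfulness** is the same with all edges reversed: latent variables for u-leaves, observed variables for nu-leaves, $Ch$, $De$, $\mathrm{TC}$ for $Pa$, $An$,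 $\mathrm{TE}$. **Direct ordered groups (DOG).** In a SEM-ME, a u-leaf $Z_l$ is assigned to its parent $V_i$ if $Pa(Z_l)\setminus\{V_i\}\subseteq Pa(V_i)$ and $Pa(Z_l)\subseteq Pa(V_k)$ for all $V_k\in Ch(V_i)\setminus\{Z_l\}$. The groups are: each nu-leaf with the u-leaves assigned to it, and each unassigned u-leaf alone. In a SEM-UR, a latent $H_l$ is assigned to its child $X_i$ if $Ch(H_l)\setminus\{X_i\}\subseteq Ch(X_i)$ and $Ch(H_l)\subseteq Ch(V_k)$ for all $V_k\in Pa(X_i)\setminus\{H_l\}$; the groups are each observed variable with the latents assigned to it, and each unassigned latent alone. **DOG equivalence.** Two SEM-MEs with the same $\mathcal Z,\mathcal Y$ are DOG-equivalent if their mixing matrices agree up to permutation and scaling of the columns, they have the same groups, and the same groups contain a nu-leaf. Two SEM-URs with the same $X$ (and as many latents) are DOG-equivalent if their exogenous noise terms can be matched so that the mixing matrices agree up to scaling of the columns, the groups (as sets of exogenous noise terms) are the same, and for each $j$ the group containing $X_j$ is the same. **Theorem.** Let $M$ be a canonical linear SEM-ME (resp. a linear SEM-UR) that satisfies both parts (a)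 and (b) of SEM-ME (resp. SEM-UR) faithfulness, and let its mixing matrix be known up to permutation and scaling of the columns (separability). Then $M$ is identified exactly up to its DOG equivalence class: 1. Every model $M'$ that is DOG-equivalent to $M$ has the same mixing matrix (up to permutation and scaling of the columns), satisfies both parts of faithfulness, and has the same edges across the groups. For SEM-ME: if in each group whose nu-leaf differs in $M$ and $M'$ the two nu-leaves are interchanged, the causal diagram of $M$ becomes that of $M'$. For SEM-UR: for every matching of the noise terms as in the definition of DOG equivalence, the causal diagrams of $M$ and $M'$ agree up to a relabelling of the latents that respects the groups. 2. Every model $M'$ with the same mixing matrix (up to permutation and scaling of the columns) that is not DOG-equivalent to $M$ violates faithfulness. -/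

import Mathlib

noncomputable section

/-! ### Linear SEM with measurement error (SEM-ME) -/

/-- The weighted causal diagram of a canonical linear SEM-ME on the underlying variables `V`.
The variables in `Y` are observed; every variable in `Z = Yᶜ` is only seen through a noisy
measurement. `coef i j` is the coefficient of `V_j` in the structural equation of `V_i`. -/
structure SEMME (V : Type*) (Y : Set V) where
  coef : Matrix V V ℝ
  causalOrder : ∃ o : V → ℕ, Function.Injective o ∧ ∀ i j, coef i j ≠ 0 → o j < o i

namespace SEMME

variable {V : Type*} {Y : Set V} (M : SEMME V Y)

/-- Parents. -/
def Pa (v : V) : Set V := {u | M.coef v u ≠ 0}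

/-- Children. -/
def Ch (v : V) : Set V := {w | M.coef w v ≠ 0}

/-- Ancestors, i.e. the variables with a directed path (of at least one edge) to `v`. -/
def An (v : V) : Set V := {u | Relation.TransGen (fun a b => M.coef b a ≠ 0) u v}

/-- A u-leaf node: unobserved and without children. -/
def IsULeaf (v : V) : Prop := v ∉ Y ∧ M.Ch v = ∅

/-- The nu-leaf nodes. -/
abbrev NU : Type _ := {v : V // ¬ M.IsULeaf v}

instance [Finite V] : Fintype M.NU := Fintype.ofFinite _

/-- The matrix `C` of the coefficients among the nu-leaf nodes. -/
def coefC : Matrix M.NU M.NU ℝ := fun i j => M.coef i j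

/-- The matrix `D` of the coefficients from the nu-leaf nodes to the u-leaf nodes. -/
def coefD : Matrix {v : V // M.IsULeaf v} M.NU ℝ := fun i j => M.coef i j

open Classical in
/-- The mixing matrix `W^ME`. In the canonical form the u-leaf nodes have no exogenous noise, so
the columns are indexed by the nu-leaf nodes (through their noise terms). The rows of the u-leaf
nodes form `D (I - C)⁻¹`, the rows of the nu-leaf nodes form `(I - C)⁻¹`. -/
def mixing [Finite V] : Matrix V M.NU ℝ := fun v j =>
  if h : M.IsULeaf v then (M.coefD * (1 - M.coefC)⁻¹) ⟨v, h⟩ j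
  else ((1 - M.coefC)⁻¹) ⟨v, h⟩ j

/-- Two models have the same mixing matrix up to permutation and scaling of the columns. The rows
are labelled by the underlying variables. -/
def SameMixing [Finite V] (M M' : SEMME V Y) : Prop :=
  ∃ (π : M.NU ≃ M'.NU) (s : M.NU → ℝ), (∀ j, s j ≠ 0) ∧
    ∀ v j, M'.mixing v (π j) = s j * M.mixing v j

section TotalEffect

variable [Fintype V] [DecidableEq V]

/-- The total causal effect of `u` on `v`, i.e. the sum over all directed paths from `u` to `v` of
the product of the coefficients along the path: the entry `(v, u)` of `coef ^ k` is the
contribution of the paths with `k` edges, and no path has `card V` edges or more. The effect of a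
variable on itself is `1` (the empty path). -/
def TE (u v : V) : ℝ := ∑ k ∈ Finset.range (Fintype.card V), (M.coef ^ k) v u

/-- The vector of the total causal effects of the elements of `T` on `v`. -/
def TEvec (T : Set V) (v : V) : T → ℝ := fun u => M.TE u v

end TotalEffect

/-- The possible parents of `v`: its ancestors, and the u-leaf nodes other than `v` all of whose
parents are ancestors of `v`. -/
def PossPa (v : V) : Set V := {u | u ≠ v ∧ (u ∈ M.An v ∨ (M.IsULeaf u ∧ M.Pa u ⊆ M.An v))}

/-- Part (a) of SEM-ME faithfulness. -/
def FaithfulA [Fintype V] [DecidableEq V] : Prop := ∀ u v, u ∈ M.An v → M.TE u v ≠ 0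

/-- Part (b1): the total effects of the ancestors of `v` on `v` are not a linear combination of
those on `k ≤ |Pa v|` possible parents, except when `k = |Pa v|` and all u-leaf nodes among these
have their parents in `Pa v`. -/
def FaithfulB1 [Fintype V] [DecidableEq V] : Prop :=
  ∀ (v : V) (S : Finset V), (∀ u ∈ S, u ∈ M.PossPa v) → S.card ≤ (M.Pa v).ncard →
    M.TEvec (M.An v) v ∈ Submodule.span ℝ (M.TEvec (M.An v) '' (S : Set V)) →
    S.card = (M.Pa v).ncard ∧ ∀ l ∈ S, M.IsULeaf l → M.Pa l ⊆ M.Pa v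

/-- Part (b2), for a u-leaf node `i` and a parent `j` of it; the bound `k ≤ |Pa j ∪ Pa i| - 1` is
written as `k + 1 ≤ |Pa j ∪ Pa i|`. -/
def FaithfulB2 [Fintype V] [DecidableEq V] : Prop :=
  ∀ i, M.IsULeaf i → ∀ j ∈ M.Pa i, ∀ S : Finset V, (∀ u ∈ S, u ∈ M.PossPa j) →
    S.card + 1 ≤ (M.Pa j ∪ M.Pa i).ncard →
    M.TEvec (M.An i \ {j}) i ∈ Submodule.span ℝ (M.TEvec (M.An i \ {j}) '' (S : Set V)) →
    S.card + 1 = (M.Pa j ∪ M.Pa i).ncard ∧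
      ∀ l ∈ S, M.IsULeaf l → M.Pa l ⊆ M.Pa j ∪ M.Pa i

/-- SEM-ME faithfulness, parts (a) and (b). -/
def Faithful [Fintype V] [DecidableEq V] : Prop := M.FaithfulA ∧ M.FaithfulB1 ∧ M.FaithfulB2

/-- The edge identifiability condition for an edge from the nu-leaf node `i` to the u-leaf node
`l`. -/
def EdgeIdent (i l : V) : Prop :=
  ¬ (M.Pa l \ {i} ⊆ M.Pa i) ∨ ¬ (M.Pa l ⊆ ⋂ k ∈ M.Ch i \ {l}, M.Pa k)

/-- The u-leaf node `l` is assigned to the direct ordered group of its parent `i`. -/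
def Assigned (i l : V) : Prop := M.IsULeaf l ∧ i ∈ M.Pa l ∧ ¬ M.EdgeIdent i l

/-- The direct ordered grouping: one group for each nu-leaf node, consisting of this node (the
center) and the u-leaf nodes assigned to it, and a separate group for each remaining u-leaf
node. -/
def DOG : Set (Set V) :=
  {G | ∃ i, ¬ M.IsULeaf i ∧ G = {i} ∪ {l | M.Assigned i l}} ∪
  {G | ∃ l, M.IsULeaf l ∧ (∀ i, ¬ M.Assigned i l) ∧ G = {l}}

/-- Two variables lie in the same direct ordered group. -/
def SameGroup (u v : V) : Prop := ∃ G ∈ M.DOG, u ∈ G ∧ v ∈ G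

/-- DOG equivalence: the same mixing matrix up to permutation and scaling of the columns, and the
same direct ordered groups, where the groups around an nu-leaf node are the same in both models
(the choice of the nu-leaf node in the group is free). -/
def DOGEquiv [Finite V] (M M' : SEMME V Y) : Prop :=
  SameMixing M M' ∧ M.DOG = M'.DOG ∧
    ∀ G ∈ M.DOG, (∃ v ∈ G, ¬ M.IsULeaf v) ↔ ∃ v ∈ G, ¬ M'.IsULeaf v

/-- `M` and `M'` have the same edges across the groups (and the same star in each group): when, in
each group whose center is not the same in both models, the old and the new center are
interchanged, the edges of `M` become those of `M'`. -/
def SameEdges (M M' : SEMME V Y) : Prop :=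
  ∃ σ : Equiv.Perm V, (∀ v, M.SameGroup v (σ v)) ∧
    (∀ v, M.IsULeaf v ↔ M'.IsULeaf (σ v)) ∧
    (∀ v, (M.IsULeaf v ↔ M'.IsULeaf v) → σ v = v) ∧
    ∀ u v, u ∈ M.Pa v ↔ σ u ∈ M'.Pa (σ v)

end SEMME

/-! ### Linear SEM with unobserved roots (SEM-UR) -/

/-- The weighted causal diagram of a linear SEM-UR with latent variables `H` (all of them roots)
and observed variables `X`: `B j i` is the coefficient of `H_i` and `A j k` the coefficient of
`X_k` in the structural equation of `X_j`. -/
structure SEMUR (H X : Type*) where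
  A : Matrix X X ℝ
  B : Matrix X H ℝ
  causalOrder : ∃ o : X → ℕ, Function.Injective o ∧ ∀ j k, A j k ≠ 0 → o k < o j

namespace SEMUR

variable {H X : Type*} (M : SEMUR H X)

/-- The coefficients of the whole causal diagram, with the nodes `H ⊕ X`; `coef v u` is the weight
of the edge from `u` to `v`. -/
def coef : Matrix (H ⊕ X) (H ⊕ X) ℝ := Matrix.fromBlocks 0 0 M.B M.A

/-- Parents. -/
def Pa (v : H ⊕ X) : Set (H ⊕ X) := {u | M.coef v u ≠ 0}

/-- Children. -/
def Ch (v : H ⊕ X) : Set (H ⊕ X) := {w | M.coef w v ≠ 0}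

/-- Descendants, i.e. the variables with a directed path (of at least one edge) from `v`. -/
def De (v : H ⊕ X) : Set (H ⊕ X) := {w | Relation.TransGen (fun a b => M.coef b a ≠ 0) v w}

/-- The mixing matrix `W^UR = [(I - A)⁻¹ B, (I - A)⁻¹]`; the column `v` belongs to the exogenous
noise term of the variable `v`. -/
def mixing [Fintype X] [DecidableEq X] : Matrix X (H ⊕ X) ℝ :=
  Matrix.fromCols ((1 - M.A)⁻¹ * M.B) ((1 - M.A)⁻¹)

/-- The columns of the two mixing matrices agree up to scaling when the exogenous noise term of
`v` in `M` is identified with the exogenous noise term of `π v` in `M'`. -/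
def NoiseMatch [Fintype X] [DecidableEq X] (M M' : SEMUR H X)
    (π : Equiv.Perm (H ⊕ X)) : Prop :=
  ∃ s : H ⊕ X → ℝ, (∀ v, s v ≠ 0) ∧ ∀ x v, M'.mixing x (π v) = s v * M.mixing x v

/-- Two models have the same mixing matrix up to permutation and scaling of the columns. -/
def SameMixing [Fintype X] [DecidableEq X] (M M' : SEMUR H X) : Prop :=
  ∃ π, NoiseMatch M M' π

section TotalEffect

variable [Fintype H] [DecidableEq H] [Fintype X] [DecidableEq X]

/-- The total causal effect of `u` on `v`: the sum over all directed paths from `u` to `v` of the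
product of the coefficients along the path. -/
def TE (u v : H ⊕ X) : ℝ := ∑ k ∈ Finset.range (Fintype.card (H ⊕ X)), (M.coef ^ k) v u

/-- The vector of the total causal effects of `v` on the elements of `T`. -/
def TCvec (T : Set (H ⊕ X)) (v : H ⊕ X) : T → ℝ := fun w => M.TE v w

end TotalEffect

/-- A latent variable. -/
def IsLatent (v : H ⊕ X) : Prop := v.isLeft = true

/-- The possible children of `v`: its descendants, and the latent variables other than `v` all of
whose children are descendants of `v`. -/
def PossCh (v : H ⊕ X) : Set (H ⊕ X) :=
  {u | u ≠ v ∧ (u ∈ M.De v ∨ (IsLatent u ∧ M.Ch u ⊆ M.De v))}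

section Faithfulness

variable [Fintype H] [DecidableEq H] [Fintype X] [DecidableEq X]

/-- Part (a) of SEM-UR faithfulness. -/
def FaithfulA : Prop := ∀ u v, v ∈ M.De u → M.TE u v ≠ 0

/-- Part (b1): the total effects of `v` on its descendants are not a linear combination of those of
`k ≤ |Ch v|` possible children, except when `k = |Ch v|` and all latent variables among these have
their children in `Ch v`. -/
def FaithfulB1 : Prop :=
  ∀ (v : H ⊕ X) (S : Finset (H ⊕ X)), (∀ u ∈ S, u ∈ M.PossCh v) → S.card ≤ (M.Ch v).ncard →
    M.TCvec (M.De v) v ∈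
      Submodule.span ℝ (M.TCvec (M.De v) '' (S : Set (H ⊕ X))) →
    S.card = (M.Ch v).ncard ∧ ∀ l ∈ S, IsLatent l → M.Ch l ⊆ M.Ch v

/-- Part (b2), for a latent variable `i` and a child `j` of it; the bound
`k ≤ |Ch j ∪ Ch i| - 1` is written as `k + 1 ≤ |Ch j ∪ Ch i|`. -/
def FaithfulB2 : Prop :=
  ∀ i, IsLatent i → ∀ j ∈ M.Ch i, ∀ S : Finset (H ⊕ X), (∀ u ∈ S, u ∈ M.PossCh j) →
    S.card + 1 ≤ (M.Ch j ∪ M.Ch i).ncard →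
    M.TCvec (M.De i \ {j}) i ∈
      Submodule.span ℝ (M.TCvec (M.De i \ {j}) '' (S : Set (H ⊕ X))) →
    S.card + 1 = (M.Ch j ∪ M.Ch i).ncard ∧
      ∀ l ∈ S, IsLatent l → M.Ch l ⊆ M.Ch j ∪ M.Ch i

/-- SEM-UR faithfulness, parts (a) and (b). -/
def Faithful : Prop := M.FaithfulA ∧ M.FaithfulB1 ∧ M.FaithfulB2

end Faithfulness

/-- The edge identifiability condition for an edge from the latent variable `l` to the observed
variable `i`. -/
def EdgeIdent (l i : H ⊕ X) : Prop :=
  ¬ (M.Ch l \ {i} ⊆ M.Ch i) ∨ ¬ (M.Ch l ⊆ ⋂ k ∈ M.Pa i \ {l}, M.Ch k)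

/-- The latent variable `l` is assigned to the direct ordered group of its child `i`. -/
def Assigned (i l : H ⊕ X) : Prop := IsLatent l ∧ i ∈ M.Ch l ∧ ¬ M.EdgeIdent l i

/-- The direct ordered grouping: one group for each observed variable, consisting of this variable
(the center) and the latent variables assigned to it, and a separate group for each remaining
latent variable. -/
def DOG : Set (Set (H ⊕ X)) :=
  {G | ∃ i, ¬ IsLatent i ∧ G = {i} ∪ {l | M.Assigned i l}} ∪
  {G | ∃ l, IsLatent l ∧ (∀ i, ¬ M.Assigned i l) ∧ G = {l}}

/-- Two variables lie in the same direct ordered group. -/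
def SameGroup (u v : H ⊕ X) : Prop := ∃ G ∈ M.DOG, u ∈ G ∧ v ∈ G

/-- The two models have, under the identification `π` of their exogenous noise terms, the same
mixing matrix up to scaling of the columns, and the same direct ordered groups (a group being
viewed as the set of the exogenous noise terms of its members), where the group around the observed
variable `X_j` is the same in both models for each `j` (the assignment of the noise terms within
the group is free). -/
def DOGMatch [Fintype X] [DecidableEq X] (M M' : SEMUR H X)
    (π : Equiv.Perm (H ⊕ X)) : Prop :=
  NoiseMatch M M' π ∧ (fun G => π '' G) '' M.DOG = M'.DOG ∧
    ∀ x : X, M'.SameGroup (π (Sum.inr x)) (Sum.inr x)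

/-- DOG equivalence. -/
def DOGEquiv [Fintype X] [DecidableEq X] (M M' : SEMUR H X) : Prop :=
  ∃ π, DOGMatch M M' π

/-- `M` and `M'` have the same edges (across the groups and within them), up to a relabelling `τ`
of the latent variables that respects the groups. -/
def SameEdges (M M' : SEMUR H X) (π : Equiv.Perm (H ⊕ X)) : Prop :=
  ∃ τ : Equiv.Perm H, (∀ h, M'.SameGroup (π (Sum.inl h)) (Sum.inl (τ h))) ∧
    (∀ x h, M.B x h ≠ 0 ↔ M'.B x (τ h) ≠ 0) ∧
    ∀ x y, M.A x y ≠ 0 ↔ M'.A x y ≠ 0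

end SEMUR

end

/-!
The rows of the mixing matrix of an SEM-ME are the variables, its columns are the noise terms of the
nu-leaves, and the nu-leaf whose noise term is the column `k` is the *center* of `k`. Up to row and
column scaling, a model is then nothing but a way of choosing centers in a fixed matrix `W` such
that the rows of the centers form a triangular matrix (`MixingRep`): the coefficients of the model
are those of the expansion of each row of `W` in the rows of the centers. An SEM-UR becomes an SEM-ME
when all its edges are reversed (`SEMUR.reverse`), which transposes the mixing matrix, so that both
halves of the theorem are statements about two such representations of the same `W`; the dictionary
is `SEMME.Indexing`.

Let two faithful representations be given. By part (a) of faithfulness, the support of a row is the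
set of its ancestors, so the two centers `c k` and `c' k` of a column have the same support, and
where they differ, each is a leaf in the other model. By part (b), the parents of a row form the
smallest set of possible parents whose rows span it, and all members of another spanning set of the
same size are combinations of the centers of these parents (`Faithful.Top_subset_of_b1`,
`Faithful.Top_subset_of_b2`; here a functional dual to the rows of the centers is used). A comparison
of the two parent sets in both directions gives `Pa' (c' k) = Pa (c k)`, `Pa' (c k) = Pa (c' k)` and
`Pa' r = Pa r` for the other rows, and that `c' k` is assigned to the group of `c k`
(`Faithful.eq_or_assigned`).

Conversely, let `M` be faithful and let each `c' k` be `c k` or be assigned to it. Assignment says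
that every set of parents in `M` contains, with a column `q`, all the columns that are needed to
express the row `c' q`. Hence the centers of such a set span the same space in both models
(`Exchanged.rowOn_ctr_mem`), which bounds the parents of the second model from above, while
faithfulness of `M` bounds them from below. So interchanging the centers is an isomorphism of the
causal diagrams (`Exchanged.Pa_swap`), and each instance of faithfulness of the second model is an
instance of faithfulness of the first (`Exchanged.faithful`). DOG equivalence is precisely this
relation: the groups determine the matching of the columns, as an injection of a finite poset into
itself that nowhere increases is the identity (`exchanged_of_forall_exists`).
-/

set_option linter.unusedSectionVars false

noncomputable section

/-! ### Representations of a matrix by triangular centers -/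

/-- A linear acyclic model whose matrix of total effects is `W`, up to the scaling of the noise terms.
The rows of `W` are the nodes and its columns the noise terms. `ctr k` is the node with the noise term
`k` (which enters with the coefficient `scale k`), and `E r l` is the coefficient of the node `ctr l`
in the equation of the node `r`. Nodes that are not centers have neither noise nor children. -/
structure MixingRep {R K : Type*} [Fintype K] [DecidableEq R] (W : R → K → ℝ) where
  ctr : K → R
  ctr_inj : Function.Injective ctr
  E : R → K → ℝ
  scale : K → ℝ
  scale_ne : ∀ k, scale k ≠ 0
  eqn : ∀ r k, W r k = ∑ l, E r l * W (ctr l) k + if r = ctr k then scale k else 0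
  o : K → ℕ
  order : ∀ k l, E (ctr k) l ≠ 0 → o l < o k

/-- The row `u` of `W`, restricted to the columns in `Q`. -/
def rowOn {R K : Type*} (W : R → K → ℝ) (Q : Set K) (u : R) : Q → ℝ := fun k => W u k

/-- The span of the rows in `T`, restricted to the columns in `Q`. -/
def rowSpan {R K : Type*} (W : R → K → ℝ) (Q : Set K) (T : Set R) : Submodule ℝ (Q → ℝ) :=
  Submodule.span ℝ (rowOn W Q '' T)

section RowSpan

variable {R K : Type*} {W : R → K → ℝ} {Q : Set K} {T T' : Set R}

theorem rowOn_mem_rowSpan {u : R} (h : u ∈ T) : rowOn W Q u ∈ rowSpan W Q T :=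
  Submodule.subset_span ⟨u, h, rfl⟩

theorem rowSpan_mono (h : T ⊆ T') : rowSpan W Q T ≤ rowSpan W Q T' :=
  Submodule.span_mono (Set.image_mono h)

theorem rowSpan_le {p : Submodule ℝ (Q → ℝ)} (h : ∀ u ∈ T, rowOn W Q u ∈ p) :
    rowSpan W Q T ≤ p := by
  refine Submodule.span_le.2 ?_
  rintro _ ⟨u, hu, rfl⟩
  exact h u hu

theorem mem_rowSpan_finset {S : Finset R} {r : R} :
    rowOn W Q r ∈ rowSpan W Q (S : Set R) ↔
      ∃ w : R → ℝ, ∀ k ∈ Q, W r k = ∑ u ∈ S, w u * W u k := by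
  classical
  unfold rowSpan
  rw [Submodule.mem_span_image_finset_iff_exists_fun']
  refine exists_congr fun w => ?_
  rw [funext_iff]
  constructor
  · intro h k hk
    have := h ⟨k, hk⟩
    simp only [rowOn, Finset.sum_apply, Pi.smul_apply, smul_eq_mul] at this
    exact this.symm
  · intro h k
    simp only [rowOn, Finset.sum_apply, Pi.smul_apply, smul_eq_mul]
    exact (h k k.2).symm

/-- A functional which kills a vector `x` and all but one of the rows that are needed to express
`x` kills the remaining row, too. -/
theorem functional_eq_zero_of_mem {x : Q → ℝ} {y : R} (φ : (Q → ℝ) →ₗ[ℝ] ℝ)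
    (h : x ∈ rowSpan W Q (insert y T)) (hx : x ∉ rowSpan W Q T) (hφx : φ x = 0)
    (hφ : ∀ u ∈ T, φ (rowOn W Q u) = 0) : φ (rowOn W Q y) = 0 := by
  unfold rowSpan at *
  rw [Set.image_insert_eq, Submodule.mem_span_insert] at h
  obtain ⟨a, z, hz, rfl⟩ := h
  have hz' : φ z = 0 := by
    have : rowSpan W Q T ≤ LinearMap.ker φ := rowSpan_le fun u hu => hφ u hu
    exact this hz
  have ha : a ≠ 0 := by
    rintro rfl
    exact hx (by simpa using hz)
  simpa [hz', ha] using hφx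

end RowSpan

namespace MixingRep

section Basic

variable {R K : Type*} [Fintype K] [DecidableEq R] {W : R → K → ℝ}
  (m : MixingRep W)

open Classical in
/-- The parents of a row, given as columns: `k` stands for the node `m.ctr k`. -/
def Pa (r : R) : Finset K := Finset.univ.filter fun k => m.E r k ≠ 0

theorem mem_Pa {r : R} {k : K} : k ∈ m.Pa r ↔ m.E r k ≠ 0 := by simp [Pa]

/-- The rows that are not centers: the u-leaves of an SEM-ME, the latent variables of an SEM-UR. -/
def IsLeaf (r : R) : Prop := ∀ k, r ≠ m.ctr k

/-- The ancestors of a row, given as columns. This is the intended notion only if all total effects on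
descendants are nonzero, which is part (a) of faithfulness. -/
def An (r : R) : Set K := {k | W r k ≠ 0 ∧ r ≠ m.ctr k}

/-- The row `u` is a possible parent of the row `r`. Under part (a) of faithfulness this says for a
center `u` that it is an ancestor of `r`, and for a leaf `u` that all its parents are. -/
def Poss (r u : R) : Prop := u ≠ r ∧ ∀ k, W u k ≠ 0 → k ∈ m.An r

open Classical in
/-- The columns whose centers are needed to express the row `r`: a center needs only itself, a leaf
needs its parents. -/
def Top (r : R) : Finset K := Finset.univ.filter fun k => r = m.ctr k ∨ m.IsLeaf r ∧ k ∈ m.Pa r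

theorem isLeaf_or (r : R) : m.IsLeaf r ∨ ∃ k, r = m.ctr k := by
  unfold IsLeaf
  by_contra! h
  obtain ⟨⟨k, hk⟩, h⟩ := h
  exact h k hk

theorem not_isLeaf_ctr (k : K) : ¬ m.IsLeaf (m.ctr k) := fun h => h k rfl

theorem Top_ctr (k : K) : m.Top (m.ctr k) = {k} := by
  ext l
  simp [Top, m.not_isLeaf_ctr, m.ctr_inj.eq_iff, eq_comm]

theorem Top_leaf {r : R} (h : m.IsLeaf r) : m.Top r = m.Pa r := by
  ext l
  simp [Top, h, h l]

/-- The rows of the centers form a triangular matrix. -/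
theorem W_ctr_ne_zero {k l : K} (h : W (m.ctr k) l ≠ 0) : l = k ∨ m.o l < m.o k := by
  induction hn : m.o k using Nat.strong_induction_on generalizing k with
  | _ n ih =>
    subst hn
    by_cases hlk : l = k
    · exact Or.inl hlk
    rw [m.eqn, if_neg (fun h => hlk (m.ctr_inj h).symm), add_zero] at h
    obtain ⟨q, -, hq⟩ := Finset.exists_ne_zero_of_sum_ne_zero h
    have hqk := m.order k q (left_ne_zero_of_mul hq)
    rcases ih _ hqk (right_ne_zero_of_mul hq) rfl with rfl | h'
    · exact Or.inr hqk
    · exact Or.inr (h'.trans hqk)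

theorem W_ctr_self (k : K) : W (m.ctr k) k ≠ 0 := by
  have : W (m.ctr k) k = m.scale k := by
    rw [m.eqn, if_pos rfl, Finset.sum_eq_zero, zero_add]
    intro q _
    by_contra hq
    have h1 := m.order k q (left_ne_zero_of_mul hq)
    rcases m.W_ctr_ne_zero (right_ne_zero_of_mul hq) with rfl | h
    · omega
    · omega
  rw [this]
  exact m.scale_ne k

theorem W_ctr_antisymm {k l : K} (h : W (m.ctr k) l ≠ 0) (h' : W (m.ctr l) k ≠ 0) : k = l := by
  rcases m.W_ctr_ne_zero h with h | h
  · exact h.symm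
  rcases m.W_ctr_ne_zero h' with h' | h'
  · exact h'
  omega

theorem notMem_Pa_ctr (k : K) : k ∉ m.Pa (m.ctr k) := fun h =>
  lt_irrefl _ (m.order k k (m.mem_Pa.1 h))

theorem rowOn_eq {Q : Set K} {r : R} (h : ∀ k ∈ Q, r ≠ m.ctr k) :
    rowOn W Q r = ∑ l ∈ m.Pa r, m.E r l • rowOn W Q (m.ctr l) := by
  ext k
  simp only [rowOn, Finset.sum_apply, Pi.smul_apply, smul_eq_mul]
  rw [m.eqn, if_neg (h k k.2), add_zero]
  refine (Finset.sum_subset (Finset.subset_univ _) fun l _ hl => ?_).symm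
  have : m.E r l = 0 := by simpa [mem_Pa] using hl
  simp [this]

theorem rowOn_mem_span_Pa {Q : Set K} {r : R} (h : ∀ k ∈ Q, r ≠ m.ctr k) :
    rowOn W Q r ∈ rowSpan W Q (m.ctr '' m.Pa r) := by
  rw [m.rowOn_eq h]
  exact Submodule.sum_mem _ fun l hl => Submodule.smul_mem _ _
    (rowOn_mem_rowSpan (Set.mem_image_of_mem _ hl))

theorem rowOn_mem_span_Top (Q : Set K) (r : R) :
    rowOn W Q r ∈ rowSpan W Q (m.ctr '' m.Top r) := by
  rcases m.isLeaf_or r with h | ⟨k, rfl⟩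
  · rw [m.Top_leaf h]
    exact m.rowOn_mem_span_Pa fun k _ => h k
  · rw [m.Top_ctr]
    exact rowOn_mem_rowSpan (by simp)

theorem rowOn_mem_span_of_Top {Q : Set K} {r : R} {P : Finset K} (h : m.Top r ⊆ P) :
    rowOn W Q r ∈ rowSpan W Q (m.ctr '' P) :=
  rowSpan_mono (Set.image_mono (by exact_mod_cast h)) (m.rowOn_mem_span_Top Q r)

/-- The center of a parent `k` of `r` is a combination of `r` and the other parents. -/
theorem rowOn_ctr_mem_insert [DecidableEq K] {Q : Set K} {r : R} {k : K} (h : ∀ k ∈ Q, r ≠ m.ctr k)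
    (hk : k ∈ m.Pa r) :
    rowOn W Q (m.ctr k) ∈ rowSpan W Q (insert r (m.ctr '' ((m.Pa r).erase k))) := by
  have h1 := m.rowOn_eq h
  rw [← Finset.add_sum_erase _ _ hk] at h1
  have hE := m.mem_Pa.1 hk
  have h2 : rowOn W Q (m.ctr k) = (m.E r k)⁻¹ • (rowOn W Q r -
      ∑ l ∈ (m.Pa r).erase k, m.E r l • rowOn W Q (m.ctr l)) := by
    rw [h1, add_sub_cancel_right, smul_smul, inv_mul_cancel₀ hE, one_smul]
  rw [h2]
  refine Submodule.smul_mem _ _ (Submodule.sub_mem _ (rowOn_mem_rowSpan (by simp)) ?_)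
  exact Submodule.sum_mem _ fun l hl => Submodule.smul_mem _ _
    (rowOn_mem_rowSpan (Set.mem_insert_of_mem _ (Set.mem_image_of_mem _ hl)))

/-- Principal submatrices of the triangular matrix of the centers are invertible. -/
theorem linearIndependent_rowOn (Q : Set K) :
    LinearIndependent ℝ fun l : Q => rowOn W Q (m.ctr l) := by
  classical
  rw [Fintype.linearIndependent_iff]
  intro g hg
  by_contra! hne
  obtain ⟨i, hi⟩ := hne
  obtain ⟨j, hj, hmax⟩ := Finset.exists_max_image (Finset.univ.filter fun i => g i ≠ 0)
    (fun i : Q => m.o i) ⟨i, by simpa using hi⟩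
  have hj' : g j ≠ 0 := by simpa using hj
  have := congrFun hg j
  simp only [rowOn, Finset.sum_apply, Pi.smul_apply, smul_eq_mul, Pi.zero_apply] at this
  rw [Finset.sum_eq_single j] at this
  · exact mul_ne_zero hj' (m.W_ctr_self j) this
  · intro q _ hqj
    by_contra hne
    have h1 := hmax q (by simpa using left_ne_zero_of_mul hne)
    rcases m.W_ctr_ne_zero (right_ne_zero_of_mul hne) with h2 | h2
    · exact hqj (Subtype.ext h2.symm)
    · omega
  · simp

/-- A multiple of the functional which is dual to the row of the center of `j`. -/
theorem exists_functional {Q : Set K} {j : K} (hj : j ∈ Q) :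
    ∃ φ : (Q → ℝ) →ₗ[ℝ] ℝ, φ (rowOn W Q (m.ctr j)) ≠ 0 ∧
      ∀ l ∈ Q, l ≠ j → φ (rowOn W Q (m.ctr l)) = 0 := by
  have h := (linearIndependent_iff_notMem_span.1 (m.linearIndependent_rowOn Q)) ⟨j, hj⟩
  obtain ⟨φ, h1, h2⟩ := Submodule.exists_le_ker_of_notMem h
  refine ⟨φ, h1, fun l hl hlj => ?_⟩
  exact h2 (Submodule.subset_span ⟨⟨l, hl⟩, by simpa [Subtype.ext_iff] using hlj, rfl⟩)

/-- The expansion of a row in the rows of the centers is unique. -/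
theorem Pa_subset_of_mem_span {Q : Set K} {r : R} {P : Finset K} (h : ∀ k ∈ Q, r ≠ m.ctr k)
    (hr : (m.Pa r : Set K) ⊆ Q) (hP : (P : Set K) ⊆ Q)
    (hs : rowOn W Q r ∈ rowSpan W Q (m.ctr '' P)) : m.Pa r ⊆ P := by
  intro j hj
  by_contra hjP
  obtain ⟨φ, h1, h2⟩ := m.exists_functional (hr hj)
  have h3 : φ (rowOn W Q r) = 0 := by
    have : rowSpan W Q (m.ctr '' P) ≤ LinearMap.ker φ := by
      refine rowSpan_le ?_
      rintro _ ⟨l, hl, rfl⟩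
      exact h2 l (hP hl) fun e => hjP (e ▸ hl)
    exact this hs
  rw [m.rowOn_eq h, map_sum, Finset.sum_eq_single j] at h3
  · rw [map_smul, smul_eq_mul] at h3
    exact mul_ne_zero (m.mem_Pa.1 hj) h1 h3
  · intro l hl hlj
    rw [map_smul, h2 l (hr hl) hlj, smul_zero]
  · exact fun h => absurd hj h

/-- If the row `r` is a combination of the centers of `P`, and also of `S` with a nonzero coefficient
at the center of `j`, and the leaves in `S` need only the centers of `P`, then `j` belongs to `P`,
because nothing else could cancel the contribution of its center. -/
theorem mem_of_ctr_mem {Q : Set K} {r : R} {P : Finset K} {S : Finset R} {j : K}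
    (hP : (P : Set K) ⊆ Q) (hr : rowOn W Q r ∈ rowSpan W Q (m.ctr '' P))
    (hS : rowOn W Q r ∈ rowSpan W Q S) (hj : m.ctr j ∈ S)
    (hmin : rowOn W Q r ∉ rowSpan W Q (S.erase (m.ctr j)))
    (hS1 : ∀ u ∈ S, m.IsLeaf u → m.Pa u ⊆ P) (hS2 : ∀ l, m.ctr l ∈ S → l ∈ Q) : j ∈ P := by
  by_contra hjP
  obtain ⟨φ, h1, h2⟩ := m.exists_functional (hS2 j hj)
  have hker : rowSpan W Q (m.ctr '' P) ≤ LinearMap.ker φ := by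
    refine rowSpan_le ?_
    rintro _ ⟨l, hl, rfl⟩
    exact h2 l (hP hl) fun e => hjP (e ▸ hl)
  refine h1 (functional_eq_zero_of_mem (x := rowOn W Q r)
    (T := ((S.erase (m.ctr j) : Finset R) : Set R)) φ ?_ hmin (hker hr) ?_)
  · rw [← Finset.coe_insert, Finset.insert_erase hj]
    exact hS
  · intro u hu
    rw [Finset.mem_coe, Finset.mem_erase] at hu
    rcases m.isLeaf_or u with h | ⟨l, rfl⟩
    · exact hker (m.rowOn_mem_span_of_Top (by rw [m.Top_leaf h]; exact hS1 u hu.2 h))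
    · exact h2 l (hS2 l hu.2) fun e => hu.1 (e ▸ rfl)

end Basic
/-! ### Faithfulness of a representation -/

section Faithfulness

variable {R K : Type*} [Fintype K] [DecidableEq R] [DecidableEq K] {W : R → K → ℝ}
  (m : MixingRep W)

/-- Faithfulness of a representation. `edge` and `trans` together amount to part (a): total effects
are nonzero along edges, and this is inherited by paths. The fields `b1` and `b2` are the parts of
these names in the definition for an SEM-ME. -/
structure Faithful : Prop where
  edge : ∀ r k, m.E r k ≠ 0 → W r k ≠ 0
  trans : ∀ r k l, W r k ≠ 0 → W (m.ctr k) l ≠ 0 → W r l ≠ 0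
  b1 : ∀ (r : R) (S : Finset R), (∀ u ∈ S, m.Poss r u) → S.card ≤ (m.Pa r).card →
    rowOn W (m.An r) r ∈ rowSpan W (m.An r) S →
    S.card = (m.Pa r).card ∧ ∀ l ∈ S, m.IsLeaf l → m.Pa l ⊆ m.Pa r
  b2 : ∀ i, m.IsLeaf i → ∀ j ∈ m.Pa i, ∀ S : Finset R, (∀ u ∈ S, m.Poss (m.ctr j) u) →
    S.card + 1 ≤ (m.Pa (m.ctr j) ∪ m.Pa i).card →
    rowOn W (m.An i \ {j}) i ∈ rowSpan W (m.An i \ {j}) S →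
    S.card + 1 = (m.Pa (m.ctr j) ∪ m.Pa i).card ∧
      ∀ l ∈ S, m.IsLeaf l → m.Pa l ⊆ m.Pa (m.ctr j) ∪ m.Pa i

/-- The leaf `l` is assigned to the group around the center of `k`. -/
def Assigned (k : K) (l : R) : Prop :=
  m.IsLeaf l ∧ k ∈ m.Pa l ∧ (m.Pa l).erase k ⊆ m.Pa (m.ctr k) ∧
    ∀ r, r ≠ l → k ∈ m.Pa r → m.Pa l ⊆ m.Pa r

variable {m}

theorem mem_An_of_isLeaf {r : R} (h : m.IsLeaf r) {k : K} : k ∈ m.An r ↔ W r k ≠ 0 :=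
  ⟨fun h => h.1, fun h' => ⟨h', h k⟩⟩

theorem exists_mem_Pa {r : R} (h : m.IsLeaf r) {k : K} (hk : W r k ≠ 0) :
    ∃ q ∈ m.Pa r, W (m.ctr q) k ≠ 0 := by
  rw [m.eqn, if_neg (h k), add_zero] at hk
  obtain ⟨q, -, hq⟩ := Finset.exists_ne_zero_of_sum_ne_zero hk
  exact ⟨q, m.mem_Pa.2 (left_ne_zero_of_mul hq), right_ne_zero_of_mul hq⟩

theorem mem_An_ctr {k l : K} : l ∈ m.An (m.ctr k) ↔ W (m.ctr k) l ≠ 0 ∧ l ≠ k := by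
  simp [An, m.ctr_inj.eq_iff, eq_comm]

theorem Poss.W_ctr_eq_zero {k : K} {u : R} (h : m.Poss (m.ctr k) u) : W u k = 0 := by
  by_contra hne
  exact (h.2 k hne).2 rfl

theorem Poss.mem_An {r : R} {l : K} (h : m.Poss r (m.ctr l)) : l ∈ m.An r :=
  h.2 l (m.W_ctr_self l)

/-- Away from the column `j`, the row of a leaf `i` does not need the center of `j` when the parents of
this center are available. -/
theorem rowOn_mem_span_union {i : R} (hi : m.IsLeaf i) (j : K) (Q : Set K) :
    rowOn W (Q \ {j}) i ∈
      rowSpan W (Q \ {j}) (m.ctr '' ((m.Pa (m.ctr j) ∪ m.Pa i).erase j)) := by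
  refine (rowSpan_le ?_) (m.rowOn_mem_span_Pa (Q := Q \ {j}) fun k _ => hi k)
  rintro _ ⟨l, hl, rfl⟩
  by_cases hlj : l = j
  · subst hlj
    refine rowSpan_mono (Set.image_mono ?_) (m.rowOn_mem_span_Pa fun k hk => ?_)
    · intro q hq
      have : q ≠ l := fun e => m.notMem_Pa_ctr q (by rw [← e] at hq; exact hq)
      simp_all
    · exact fun e => hk.2 (m.ctr_inj e).symm
  · refine rowOn_mem_rowSpan (Set.mem_image_of_mem _ ?_)
    simp_all

namespace Faithful

variable (hF : m.Faithful)
include hF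

theorem W_ne_zero {r : R} {k : K} (h : k ∈ m.Pa r) : W r k ≠ 0 := hF.edge r k (m.mem_Pa.1 h)

theorem Pa_subset_An (r : R) : (m.Pa r : Set K) ⊆ m.An r := by
  intro k hk
  refine ⟨hF.W_ne_zero hk, ?_⟩
  rintro rfl
  exact m.notMem_Pa_ctr k hk

theorem poss_of_subset {r : R} {q : K} (hq : q ∈ m.An r) {k : K} (h : W (m.ctr q) k ≠ 0) :
    k ∈ m.An r := by
  refine ⟨hF.trans r q k hq.1 h, ?_⟩
  rintro rfl
  exact hq.2 (by rw [m.W_ctr_antisymm h hq.1])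

theorem poss_ctr {r : R} {q : K} (hq : q ∈ m.An r) : m.Poss r (m.ctr q) :=
  ⟨fun e => hq.2 e.symm, fun _ => hF.poss_of_subset hq⟩

theorem card_Pa_le {r : R} {S : Finset R} (hS : ∀ u ∈ S, m.Poss r u)
    (hs : rowOn W (m.An r) r ∈ rowSpan W (m.An r) S) : (m.Pa r).card ≤ S.card := by
  by_contra! h
  exact h.ne (hF.b1 r S hS h.le hs).1

theorem card_Pa_union_le {i : R} (hi : m.IsLeaf i) {j : K} (hj : j ∈ m.Pa i) {S : Finset R}
    (hS : ∀ u ∈ S, m.Poss (m.ctr j) u)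
    (hs : rowOn W (m.An i \ {j}) i ∈ rowSpan W (m.An i \ {j}) S) :
    (m.Pa (m.ctr j) ∪ m.Pa i).card ≤ S.card + 1 := by
  by_contra! h
  exact h.ne (hF.b2 i hi j hj S hS h.le hs).1

/-- Under `b1`, the restriction on the leaves in a spanning set of minimal size extends to its
centers: these are centers of parents of `r`. -/
theorem Top_subset_of_b1 {r : R} {S : Finset R} (hS : ∀ u ∈ S, m.Poss r u)
    (hc : S.card ≤ (m.Pa r).card) (hs : rowOn W (m.An r) r ∈ rowSpan W (m.An r) S) :
    ∀ u ∈ S, m.Top u ⊆ m.Pa r := by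
  intro u hu
  have hl := (hF.b1 r S hS hc hs).2
  rcases m.isLeaf_or u with h | ⟨j, rfl⟩
  · rw [m.Top_leaf h]
    exact hl u hu h
  · rw [m.Top_ctr, Finset.singleton_subset_iff]
    refine m.mem_of_ctr_mem (hF.Pa_subset_An r) (m.rowOn_mem_span_Pa fun k hk => hk.2) hs hu
      (fun h => ?_) hl fun l hl => (hS _ hl).mem_An
    have := hF.card_Pa_le (fun u hu => hS u (Finset.mem_of_mem_erase hu)) h
    have := Finset.card_erase_lt_of_mem hu
    omega

theorem union_erase_subset {i : R} {j : K} (hj : j ∈ m.Pa i) :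
    (((m.Pa (m.ctr j) ∪ m.Pa i).erase j : Finset K) : Set K) ⊆ m.An i \ {j} := by
  intro k hk
  simp only [Finset.coe_erase, Finset.coe_union, Set.mem_sdiff, Set.mem_union] at hk
  refine ⟨?_, hk.2⟩
  rcases hk.1 with h | h
  · exact hF.poss_of_subset (hF.Pa_subset_An i hj) (hF.W_ne_zero h)
  · exact hF.Pa_subset_An i h

/-- The analogue of `Top_subset_of_b1` for `b2`. -/
theorem Top_subset_of_b2 {i : R} (hi : m.IsLeaf i) {j : K} (hj : j ∈ m.Pa i) {S : Finset R}
    (hS : ∀ u ∈ S, m.Poss (m.ctr j) u)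
    (hc : S.card + 1 ≤ (m.Pa (m.ctr j) ∪ m.Pa i).card)
    (hs : rowOn W (m.An i \ {j}) i ∈ rowSpan W (m.An i \ {j}) S) :
    ∀ u ∈ S, m.Top u ⊆ (m.Pa (m.ctr j) ∪ m.Pa i).erase j := by
  have hl : ∀ u ∈ S, m.IsLeaf u → m.Pa u ⊆ (m.Pa (m.ctr j) ∪ m.Pa i).erase j := by
    intro u hu hleaf
    refine Finset.subset_erase.2 ⟨(hF.b2 i hi j hj S hS hc hs).2 u hu hleaf, fun h => ?_⟩
    exact hF.W_ne_zero h (hS u hu).W_ctr_eq_zero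
  intro u hu
  rcases m.isLeaf_or u with h | ⟨q, rfl⟩
  · rw [m.Top_leaf h]
    exact hl u hu h
  · rw [m.Top_ctr, Finset.singleton_subset_iff]
    refine m.mem_of_ctr_mem (hF.union_erase_subset hj) (rowOn_mem_span_union hi j _) hs hu
      (fun h => ?_) hl fun l hl => ?_
    · have := hF.card_Pa_union_le hi hj (fun u hu => hS u (Finset.mem_of_mem_erase hu)) h
      have := Finset.card_erase_lt_of_mem hu
      omega
    · have := (mem_An_ctr.1 (hS _ hl).mem_An)
      exact ⟨hF.poss_of_subset (hF.Pa_subset_An i hj) this.1, this.2⟩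

end Faithful

end Faithfulness

/-! ### Two representations whose centers have the same supports -/

section Compare

variable {R K : Type*} [Fintype K] [DecidableEq R] [DecidableEq K] {W : R → K → ℝ}
  {m m' : MixingRep W}

/-- The two centers of each column have rows with the same support. -/
def Parallel (m m' : MixingRep W) : Prop := ∀ k l, W (m.ctr k) l ≠ 0 ↔ W (m'.ctr k) l ≠ 0

/-- The row `r` is a leaf in both representations, or the center of the same column in both. -/
def SameAt (m m' : MixingRep W) (r : R) : Prop := ∀ k, r = m.ctr k ↔ r = m'.ctr k

namespace SameAt

variable {r : R} (h : SameAt m m' r)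
include h

theorem symm : SameAt m' m r := fun k => (h k).symm

theorem An_eq : m.An r = m'.An r := by
  ext k
  simp [An, h k]

theorem poss_iff {u : R} : m.Poss r u ↔ m'.Poss r u := by simp [Poss, h.An_eq]

theorem isLeaf_iff : m.IsLeaf r ↔ m'.IsLeaf r := by simp [IsLeaf, h _]

end SameAt

variable (m m') in
/-- Besides the rows with the same role in both, there are the second and the first centers of the
columns whose centers differ. -/
theorem sameAt_or (r : R) : SameAt m m' r ∨ (∃ k, r = m'.ctr k ∧ m'.ctr k ≠ m.ctr k) ∨
    ∃ k, r = m.ctr k ∧ m'.ctr k ≠ m.ctr k := by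
  by_contra! hc
  obtain ⟨h1, h2, h3⟩ := hc
  refine h1 fun k => ⟨fun e => ?_, fun e => ?_⟩
  · rw [h3 k e, e]
  · rw [← h2 k e, e]

namespace Parallel

theorem of_faithful (hF : m.Faithful) (hF' : m'.Faithful) : Parallel m m' := fun k _ =>
  ⟨hF.trans _ _ _ (m'.W_ctr_self k), hF'.trans _ _ _ (m.W_ctr_self k)⟩

variable (h : Parallel m m')
include h

theorem symm : Parallel m' m := fun k l => (h k l).symm

theorem eq_of_ctr_eq {j k : K} (e : m'.ctr k = m.ctr j) : k = j := by
  refine m.W_ctr_antisymm ((h k j).2 ?_) ?_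
  · rw [e]; exact m.W_ctr_self j
  · rw [← e]; exact m'.W_ctr_self k

theorem isLeaf {k : K} (hk : m'.ctr k ≠ m.ctr k) : m.IsLeaf (m'.ctr k) := by
  intro j e
  have := h.eq_of_ctr_eq e
  exact hk (this ▸ e)

theorem mem_Pa {k : K} (hk : m'.ctr k ≠ m.ctr k)
    (hE : ∀ q ∈ m.Pa (m'.ctr k), W (m'.ctr k) q ≠ 0) : k ∈ m.Pa (m'.ctr k) := by
  obtain ⟨q, hq, hqk⟩ := exists_mem_Pa (h.isLeaf hk) (m'.W_ctr_self k)
  have := m.W_ctr_antisymm hqk ((h k q).2 (hE q hq))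
  exact this ▸ hq

theorem mem_Top (hF : m.Faithful) (k : K) : k ∈ m.Top (m'.ctr k) := by
  by_cases hk : m'.ctr k = m.ctr k
  · rw [hk, m.Top_ctr]; simp
  · rw [m.Top_leaf (h.isLeaf hk)]
    exact h.mem_Pa hk fun _ => hF.W_ne_zero

theorem mem_of_Top_subset (hF : m.Faithful) {P P' : Finset K}
    (hP : ∀ u ∈ P'.image m'.ctr, m.Top u ⊆ P) : P' ⊆ P := fun k hk =>
  hP _ (Finset.mem_image_of_mem _ hk) (h.mem_Top hF k)

theorem poss {r : R} (hF : m.Faithful) {q : K} (hq : q ∈ m.An r) (hr : r ≠ m'.ctr q) :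
    m.Poss r (m'.ctr q) :=
  ⟨hr.symm, fun k hk => hF.poss_of_subset hq ((h q k).2 hk)⟩

theorem An_ctr (k : K) : m'.An (m'.ctr k) = m.An (m.ctr k) := by
  ext l
  rw [mem_An_ctr, mem_An_ctr, h k l]

/-- Where the two centers of `k` differ, the second one has in the first representation the additional
ancestor `k`. -/
theorem An_leaf {k : K} (hk : m'.ctr k ≠ m.ctr k) : m.An (m'.ctr k) \ {k} = m'.An (m'.ctr k) := by
  ext l
  rw [mem_An_ctr, Set.mem_sdiff, mem_An_of_isLeaf (h.isLeaf hk)]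
  rfl

theorem poss_ctr_iff {k : K} {u : R} : m.Poss (m.ctr k) u ↔ m'.Poss (m'.ctr k) u := by
  have key : ∀ {m m' : MixingRep W}, Parallel m m' →
      m.Poss (m.ctr k) u → m'.Poss (m'.ctr k) u := by
    intro m m' h hu
    refine ⟨?_, by rw [h.An_ctr]; exact hu.2⟩
    rintro rfl
    exact m'.W_ctr_self k hu.W_ctr_eq_zero
  exact ⟨key h, key h.symm⟩

end Parallel

section Common

namespace Parallel

variable (h : Parallel m m')
include h

/-!
The next three groups of lemmas use the parents in the second representation as a spanning set in
the first one, for a row with the same role in both, for the second center of a column, and for its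
first center. Upper bounds for the parents in the second representation appear as hypotheses, so
that its faithfulness is not needed.
-/

theorem poss_image_of_sameAt (hF : m.Faithful) {r : R} (hr : SameAt m m' r)
    (hP : (m'.Pa r : Set K) ⊆ m.An r) : ∀ u ∈ (m'.Pa r).image m'.ctr, m.Poss r u := by
  intro u hu
  obtain ⟨q, hq, rfl⟩ := Finset.mem_image.1 hu
  exact h.poss hF (hP hq) fun e => (hP hq).2 ((hr q).2 e)

omit h in
theorem span_image_of_sameAt {r : R} (hr : SameAt m m' r) :
    rowOn W (m.An r) r ∈ rowSpan W (m.An r) ((m'.Pa r).image m'.ctr : Finset R) := by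
  rw [Finset.coe_image]
  exact m'.rowOn_mem_span_Pa fun k hk e => hk.2 ((hr k).2 e)

theorem card_le_of_sameAt (hF : m.Faithful) {r : R} (hr : SameAt m m' r)
    (hP : (m'.Pa r : Set K) ⊆ m.An r) : (m.Pa r).card ≤ (m'.Pa r).card :=
  (hF.card_Pa_le (h.poss_image_of_sameAt hF hr hP) (span_image_of_sameAt hr)).trans
    Finset.card_image_le

theorem poss_image_ctr (hF : m.Faithful) {k : K}
    (hP : (m'.Pa (m'.ctr k) : Set K) ⊆ m.An (m.ctr k)) :
    ∀ u ∈ (m'.Pa (m'.ctr k)).image m'.ctr, m.Poss (m.ctr k) u := by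
  intro u hu
  obtain ⟨q, hq, rfl⟩ := Finset.mem_image.1 hu
  refine h.poss hF (hP hq) fun e => ?_
  have := h.symm.eq_of_ctr_eq e
  exact (mem_An_ctr.1 (hP hq)).2 this.symm

theorem span_image_ctr {k : K} (hk : m'.ctr k ≠ m.ctr k) :
    rowOn W (m.An (m'.ctr k) \ {k}) (m'.ctr k) ∈
      rowSpan W (m.An (m'.ctr k) \ {k}) ((m'.Pa (m'.ctr k)).image m'.ctr : Finset R) := by
  rw [Finset.coe_image, h.An_leaf hk]
  exact m'.rowOn_mem_span_Pa fun l hl => hl.2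

/-- `b2` of the first representation at the second center of `k`. -/
theorem card_union_le (hF : m.Faithful) {k : K} (hk : m'.ctr k ≠ m.ctr k)
    (hP : (m'.Pa (m'.ctr k) : Set K) ⊆ m.An (m.ctr k)) :
    (m.Pa (m.ctr k) ∪ m.Pa (m'.ctr k)).card ≤ (m'.Pa (m'.ctr k)).card + 1 :=
  (hF.card_Pa_union_le (h.isLeaf hk) (h.mem_Pa hk fun _ => hF.W_ne_zero)
    (h.poss_image_ctr hF hP) (h.span_image_ctr hk)).trans
    (Nat.add_le_add_right Finset.card_image_le 1)

theorem poss_insert (hF : m.Faithful) {k : K} (hk : m'.ctr k ≠ m.ctr k)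
    (hP : ∀ q ∈ m'.Pa (m.ctr k), W (m.ctr k) q ≠ 0) :
    ∀ u ∈ insert (m.ctr k) (((m'.Pa (m.ctr k)).erase k).image m'.ctr),
      m.Poss (m'.ctr k) u := by
  intro u hu
  have hsupp : ∀ l, W (m.ctr k) l ≠ 0 → l ∈ m.An (m'.ctr k) := fun l hl =>
    (mem_An_of_isLeaf (h.isLeaf hk)).2 ((h k l).1 hl)
  rcases Finset.mem_insert.1 hu with rfl | hu
  · exact ⟨hk.symm, hsupp⟩
  · obtain ⟨q, hq, rfl⟩ := Finset.mem_image.1 hu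
    rw [Finset.mem_erase] at hq
    exact h.poss hF (hsupp q (hP q hq.2)) fun e => hq.1 (m'.ctr_inj e).symm

/-- In the second representation, the row of the second center of `k` is a combination of the first
center, which has `k` as a parent there, and of its other parents. -/
theorem span_insert {k : K} (hk : m'.ctr k ≠ m.ctr k)
    (hP : ∀ q ∈ m'.Pa (m.ctr k), W (m.ctr k) q ≠ 0) (Q : Set K) :
    rowOn W Q (m'.ctr k) ∈ rowSpan W Q
      (insert (m.ctr k) (((m'.Pa (m.ctr k)).erase k).image m'.ctr) : Finset R) := by
  rw [Finset.coe_insert, Finset.coe_image]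
  exact m'.rowOn_ctr_mem_insert (fun l _ => h.symm.isLeaf hk.symm l) (h.symm.mem_Pa hk.symm hP)

theorem card_insert_le {k : K} (hk : m'.ctr k ≠ m.ctr k)
    (hP : ∀ q ∈ m'.Pa (m.ctr k), W (m.ctr k) q ≠ 0) :
    (insert (m.ctr k) (((m'.Pa (m.ctr k)).erase k).image m'.ctr)).card ≤
      (m'.Pa (m.ctr k)).card := by
  refine (Finset.card_insert_le _ _).trans ?_
  refine (Nat.add_le_add_right Finset.card_image_le 1).trans ?_
  rw [Finset.card_erase_add_one (h.symm.mem_Pa hk.symm hP)]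

theorem card_leaf_le (hF : m.Faithful) {k : K} (hk : m'.ctr k ≠ m.ctr k)
    (hP : ∀ q ∈ m'.Pa (m.ctr k), W (m.ctr k) q ≠ 0) :
    (m.Pa (m'.ctr k)).card ≤ (m'.Pa (m.ctr k)).card :=
  (hF.card_Pa_le (h.poss_insert hF hk hP) (h.span_insert hk hP _)).trans
    (h.card_insert_le hk hP)

end Parallel

end Common

/-! ### Two faithful representations -/

section BothFaithful

namespace Faithful

variable (hF : m.Faithful) (hF' : m'.Faithful)
include hF hF'

/-- The parent sets in the two representations are spanning sets of each other, hence of the same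
size, and `b1` compares them. -/
theorem Pa_eq_of_sameAt {r : R} (hr : SameAt m m' r) :
    m.Pa r = m'.Pa r ∧ ∀ q ∈ m.Pa r, m.Top (m'.ctr q) ⊆ m.Pa r := by
  have h := Parallel.of_faithful hF hF'
  have hP : (m'.Pa r : Set K) ⊆ m.An r := hr.An_eq ▸ hF'.Pa_subset_An r
  have h1 := h.card_le_of_sameAt hF hr hP
  have h2 := h.symm.card_le_of_sameAt hF' hr.symm (hr.An_eq ▸ hF.Pa_subset_An r)
  have h3 := hF.Top_subset_of_b1 (h.poss_image_of_sameAt hF hr hP)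
    (Finset.card_image_le.trans h2) (Parallel.span_image_of_sameAt hr)
  have h4 : m'.Pa r = m.Pa r :=
    Finset.eq_of_subset_of_card_le (h.mem_of_Top_subset hF h3) h1
  exact ⟨h4.symm, fun q hq => h3 _ (Finset.mem_image_of_mem _ (h4 ▸ hq))⟩

/-- Here `b2` of `m` is played off against `b1` of `m'`, at the row of the second center of `k`. -/
theorem Pa_ctr_eq_union {k : K} (hk : m'.ctr k ≠ m.ctr k) :
    m'.Pa (m'.ctr k) = (m.Pa (m.ctr k) ∪ m.Pa (m'.ctr k)).erase k ∧
      ∀ q ∈ m'.Pa (m'.ctr k),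
        m.Top (m'.ctr q) ⊆ (m.Pa (m.ctr k) ∪ m.Pa (m'.ctr k)).erase k := by
  have h := Parallel.of_faithful hF hF'
  have hleaf := h.isLeaf hk
  have hmem := h.mem_Pa hk fun _ => hF.W_ne_zero
  have hP : (m'.Pa (m'.ctr k) : Set K) ⊆ m.An (m.ctr k) := by
    rw [← h.An_ctr]
    exact hF'.Pa_subset_An _
  have h1 : (m'.Pa (m'.ctr k)).card ≤ ((m.Pa (m.ctr k) ∪ m.Pa (m'.ctr k)).erase k).card := by
    refine (hF'.card_Pa_le
      (S := ((m.Pa (m.ctr k) ∪ m.Pa (m'.ctr k)).erase k).image m.ctr) ?_ ?_).trans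
      Finset.card_image_le
    · intro u hu
      obtain ⟨q, hq, rfl⟩ := Finset.mem_image.1 hu
      have := hF.union_erase_subset hmem hq
      rw [h.An_leaf hk, h.An_ctr] at this
      exact h.poss_ctr_iff.1 (hF.poss_ctr this)
    · rw [Finset.coe_image, ← h.An_leaf hk]
      exact rowOn_mem_span_union hleaf k _
  have hmem' : k ∈ m.Pa (m.ctr k) ∪ m.Pa (m'.ctr k) := Finset.mem_union_right _ hmem
  have h2 := Finset.card_erase_add_one hmem'
  have h3 := hF.Top_subset_of_b2 hleaf hmem (h.poss_image_ctr hF hP)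
    (by have := Finset.card_image_le (s := m'.Pa (m'.ctr k)) (f := m'.ctr); omega)
    (h.span_image_ctr hk)
  have h4 := h.card_union_le hF hk hP
  exact ⟨Finset.eq_of_subset_of_card_le (h.mem_of_Top_subset hF h3) (by omega),
    fun q hq => h3 _ (Finset.mem_image_of_mem _ hq)⟩

/-- `Pa_ctr_eq_union` and its mirror image bound the parent sets of the two centers by each other. -/
theorem Pa_ctr_eq {k : K} (hk : m'.ctr k ≠ m.ctr k) :
    m'.Pa (m'.ctr k) = m.Pa (m.ctr k) ∧ (m.Pa (m'.ctr k)).erase k ⊆ m.Pa (m.ctr k) ∧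
      ∀ q ∈ m.Pa (m.ctr k), m.Top (m'.ctr q) ⊆ m.Pa (m.ctr k) := by
  obtain ⟨h1, h2⟩ := hF.Pa_ctr_eq_union hF' hk
  obtain ⟨h3, -⟩ := hF'.Pa_ctr_eq_union hF hk.symm
  have h4 : m.Pa (m.ctr k) ⊆ m'.Pa (m'.ctr k) := by
    rw [h1]
    exact Finset.subset_erase.2 ⟨Finset.subset_union_left, m.notMem_Pa_ctr k⟩
  have h5 : m'.Pa (m'.ctr k) ⊆ m.Pa (m.ctr k) := by
    rw [h3]
    exact Finset.subset_erase.2 ⟨Finset.subset_union_left, m'.notMem_Pa_ctr k⟩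
  have h6 := h5.antisymm h4
  rw [← h1, h6] at h2
  refine ⟨h6, ?_, h2⟩
  rw [← h6, h1]
  exact Finset.erase_subset_erase _ Finset.subset_union_right

/-- Here `b1` of `m` at its leaf `m'.ctr k` is applied to the spanning set that results from the equation
of `m.ctr k` in `m'`. -/
theorem Top_subset_Pa_leaf {k : K} (hk : m'.ctr k ≠ m.ctr k) :
    ∀ q ∈ (m.Pa (m'.ctr k)).erase k, m.Top (m'.ctr q) ⊆ m.Pa (m'.ctr k) := by
  have h := Parallel.of_faithful hF hF'
  have hP : ∀ q ∈ m'.Pa (m.ctr k), W (m.ctr k) q ≠ 0 := fun q => hF'.W_ne_zero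
  have hP' : ∀ q ∈ m.Pa (m'.ctr k), W (m'.ctr k) q ≠ 0 := fun q => hF.W_ne_zero
  have h1 := h.card_leaf_le hF hk hP
  have h2 := h.symm.card_leaf_le hF' hk.symm hP'
  have h3 := hF.Top_subset_of_b1 (h.poss_insert hF hk hP) ((h.card_insert_le hk hP).trans h2)
    (h.span_insert hk hP _)
  have h4 : m'.Pa (m.ctr k) ⊆ m.Pa (m'.ctr k) := by
    intro q hq
    by_cases hqk : q = k
    · rw [hqk]
      exact h.mem_Pa hk hP'
    · exact h3 _ (Finset.mem_insert_of_mem (Finset.mem_image_of_mem _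
        (Finset.mem_erase.2 ⟨hqk, hq⟩))) (h.mem_Top hF q)
  have h5 := Finset.eq_of_subset_of_card_le h4 h1
  intro q hq
  rw [← h5] at hq
  exact h3 _ (Finset.mem_insert_of_mem (Finset.mem_image_of_mem _ hq))

/-- In two faithful representations of the same matrix, the centers of a column are equal or one is
assigned to the group of the other. -/
theorem eq_or_assigned (k : K) : m'.ctr k = m.ctr k ∨ m.Assigned k (m'.ctr k) := by
  have h := Parallel.of_faithful hF hF'
  by_cases hk : m'.ctr k = m.ctr k
  · exact Or.inl hk
  refine Or.inr ⟨h.isLeaf hk, h.mem_Pa hk fun _ => hF.W_ne_zero,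
    (hF.Pa_ctr_eq hF' hk).2.1, fun r hr hkr => ?_⟩
  rw [← m.Top_leaf (h.isLeaf hk)]
  -- in each case the parents of `r` also contain what is needed to express the row `m'.ctr k`
  rcases sameAt_or m m' r with hs | ⟨j, rfl, hj⟩ | ⟨j, rfl, hj⟩
  · exact (hF.Pa_eq_of_sameAt hF' hs).2 k hkr
  · exact hF.Top_subset_Pa_leaf hF' hj k
      (Finset.mem_erase.2 ⟨fun e => hr (e ▸ rfl), hkr⟩)
  · exact (hF.Pa_ctr_eq hF' hj).2.2 k hkr

end Faithful

end BothFaithful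

/-! ### Exchanging centers within the groups -/

section Exchange

/-- Each center of `m'` is the center of the same column in `m`, or is assigned to its group. -/
def Exchanged (m m' : MixingRep W) : Prop := ∀ k, m'.ctr k = m.ctr k ∨ m.Assigned k (m'.ctr k)

namespace Assigned

theorem W_ne_zero_iff (hF : m.Faithful) {k : K} {l : R} (h : m.Assigned k l) (q : K) :
    W (m.ctr k) q ≠ 0 ↔ W l q ≠ 0 := by
  refine ⟨fun hq => hF.trans _ _ _ (hF.W_ne_zero h.2.1) hq, fun hq => ?_⟩
  obtain ⟨p, hp, hpq⟩ := exists_mem_Pa h.1 hq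
  by_cases hpk : p = k
  · exact hpk ▸ hpq
  · exact hF.trans _ _ _ (hF.W_ne_zero (h.2.2.1 (Finset.mem_erase.2 ⟨hpk, hp⟩))) hpq

/-- A leaf is assigned to at most one group, since two such centers would be parents of each other. -/
theorem unique {k k' : K} {l : R} (h : m.Assigned k l) (h' : m.Assigned k' l) : k = k' := by
  by_contra hne
  have h1 := h.2.2.1 (Finset.mem_erase.2 ⟨fun e => hne e.symm, h'.2.1⟩)
  have h2 := h'.2.2.1 (Finset.mem_erase.2 ⟨hne, h.2.1⟩)
  have := m.order _ _ (m.mem_Pa.1 h1)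
  have := m.order _ _ (m.mem_Pa.1 h2)
  omega

theorem union_eq {k : K} {l : R} (h : m.Assigned k l) :
    m.Pa (m.ctr k) ∪ m.Pa l = insert k (m.Pa (m.ctr k)) := by
  refine (Finset.union_subset (Finset.subset_insert _ _) fun q hq => ?_).antisymm
    (Finset.insert_subset (Finset.mem_union_right _ h.2.1) Finset.subset_union_left)
  by_cases hqk : q = k
  · exact Finset.mem_insert.2 (Or.inl hqk)
  · exact Finset.mem_insert_of_mem (h.2.2.1 (Finset.mem_erase.2 ⟨hqk, hq⟩))

theorem union_erase {k : K} {l : R} (h : m.Assigned k l) :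
    (m.Pa (m.ctr k) ∪ m.Pa l).erase k = m.Pa (m.ctr k) := by
  rw [h.union_eq, Finset.erase_insert (m.notMem_Pa_ctr k)]

theorem card_union {k : K} {l : R} (h : m.Assigned k l) :
    (m.Pa (m.ctr k) ∪ m.Pa l).card = (m.Pa (m.ctr k)).card + 1 := by
  rw [h.union_eq, Finset.card_insert_of_notMem (m.notMem_Pa_ctr k)]

end Assigned

/-- With each column, `P` contains the columns whose centers in `m` express its center in `m'`. -/
def ClosedUnder (m m' : MixingRep W) (P : Finset K) : Prop := ∀ q ∈ P, m.Top (m'.ctr q) ⊆ P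

namespace Exchanged

variable (hF : m.Faithful) (hX : Exchanged m m')
include hF hX

theorem parallel : Parallel m m' := by
  intro k l
  rcases hX k with h | h
  · rw [h]
  · exact h.W_ne_zero_iff hF l

omit hF in
theorem assigned {k : K} (hk : m'.ctr k ≠ m.ctr k) : m.Assigned k (m'.ctr k) :=
  (hX k).resolve_left hk

omit hF in
/-- This is the second condition in the definition of `Assigned`. -/
theorem closed_Pa (r : R) : ClosedUnder m m' (m.Pa r) := by
  intro q hq
  by_cases hk : m'.ctr q = m.ctr q
  · rw [hk, m.Top_ctr]
    simpa using hq
  · have h := hX.assigned hk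
    rw [m.Top_leaf h.1]
    by_cases hr : r = m'.ctr q
    · rw [hr]
    · exact h.2.2.2 r hr hq

/-- The centers in `m` of a closed set are combinations of its centers in `m'`. -/
theorem rowOn_ctr_mem {P : Finset K} (hP : ClosedUnder m m' P) (Q : Set K) :
    ∀ q ∈ P, rowOn W Q (m.ctr q) ∈ rowSpan W Q (m'.ctr '' P) := by
  intro q
  induction hn : m.o q using Nat.strong_induction_on generalizing q with
  | _ n ih =>
    subst hn
    intro hq
    by_cases hk : m'.ctr q = m.ctr q
    · rw [← hk]
      exact rowOn_mem_rowSpan (Set.mem_image_of_mem _ hq)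
    · have h := hX.assigned hk
      refine (rowSpan_le ?_) (m.rowOn_ctr_mem_insert (fun l _ => h.1 l) h.2.1)
      rintro u (rfl | ⟨l, hl, rfl⟩)
      · exact rowOn_mem_rowSpan (Set.mem_image_of_mem _ hq)
      · rw [Finset.mem_coe] at hl
        have hl' := Finset.mem_erase.1 hl
        refine ih _ (m.order _ _ (m.mem_Pa.1 (h.2.2.1 hl))) l rfl (hP q hq ?_)
        rw [m.Top_leaf h.1]
        exact hl'.2

theorem rowSpan_le_of_closed {P : Finset K} (hP : ClosedUnder m m' P) (Q : Set K) :
    rowSpan W Q (m.ctr '' P) ≤ rowSpan W Q (m'.ctr '' P) := by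
  refine rowSpan_le ?_
  rintro _ ⟨q, hq, rfl⟩
  exact hX.rowOn_ctr_mem hF hP Q q hq

theorem Pa_eq_of_sameAt {r : R} (hr : SameAt m m' r) : m'.Pa r = m.Pa r := by
  have hne : ∀ (n : MixingRep W), ((n.Pa r : Set K) ⊆ {k | r ≠ n.ctr k}) := by
    rintro n k hk rfl
    exact n.notMem_Pa_ctr k hk
  have hQ : {k | r ≠ m.ctr k} = {k | r ≠ m'.ctr k} := by
    ext k
    simp [hr k]
  have hsub : m'.Pa r ⊆ m.Pa r := by
    refine m'.Pa_subset_of_mem_span (Q := {k | r ≠ m'.ctr k}) (fun k hk => hk) (hne m')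
      (hQ ▸ hne m) ?_
    refine hX.rowSpan_le_of_closed hF (hX.closed_Pa r) _ (m.rowOn_mem_span_Pa ?_)
    rw [← hQ]
    exact fun k hk => hk
  refine Finset.eq_of_subset_of_card_le hsub ?_
  refine (hX.parallel hF).card_le_of_sameAt hF hr ?_
  exact fun k hk => hF.Pa_subset_An r (hsub hk)

theorem Pa_ctr_eq (k : K) : m'.Pa (m'.ctr k) = m.Pa (m.ctr k) := by
  by_cases hk : m'.ctr k = m.ctr k
  · rw [hk]
    refine hX.Pa_eq_of_sameAt hF fun l => ?_
    rw [m.ctr_inj.eq_iff, ← hk, m'.ctr_inj.eq_iff]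
  have h := hX.assigned hk
  have hp := hX.parallel hF
  have hne : ∀ (n : MixingRep W), ((n.Pa (n.ctr k) : Set K) ⊆ {k}ᶜ) := by
    rintro n l hl rfl
    exact n.notMem_Pa_ctr l hl
  have hsub : m'.Pa (m'.ctr k) ⊆ m.Pa (m.ctr k) := by
    refine m'.Pa_subset_of_mem_span (Q := {k}ᶜ) (fun l hl e => hl (m'.ctr_inj e).symm) (hne m')
      (hne m) (hX.rowSpan_le_of_closed hF (hX.closed_Pa _) _ ?_)
    have := rowOn_mem_span_union h.1 k Set.univ
    rwa [h.union_erase, ← Set.compl_eq_univ_sdiff] at this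
  refine Finset.eq_of_subset_of_card_le hsub ?_
  have h1 := hp.card_union_le hF hk fun l hl => hF.Pa_subset_An _ (hsub hl)
  rw [h.card_union] at h1
  omega

theorem Pa_leaf_eq {k : K} (hk : m'.ctr k ≠ m.ctr k) :
    m'.Pa (m.ctr k) = m.Pa (m'.ctr k) := by
  have h := hX.assigned hk
  have hp := hX.parallel hF
  have hsub : m'.Pa (m.ctr k) ⊆ m.Pa (m'.ctr k) :=
    m'.Pa_subset_of_mem_span (Q := Set.univ) (fun l _ => hp.symm.isLeaf hk.symm l)
      (Set.subset_univ _) (Set.subset_univ _) (hX.rowOn_ctr_mem hF (hX.closed_Pa _) _ k h.2.1)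
  exact Finset.eq_of_subset_of_card_le hsub
    (hp.card_leaf_le hF hk fun q hq => (hp k q).2 (hF.W_ne_zero (hsub hq)))

/-- Transfers the condition on the leaves in `b1` and `b2` from `m` to `m'`. A leaf of `m'` that is a
center of `m` is expressed in `m` by itself, and `hP` replaces it by its parents in `m'`. -/
theorem Pa_subset_of_Top_subset {P : Finset K} (hP : ClosedUnder m m' P) {l : R}
    (hl : m'.IsLeaf l) (h : m.Top l ⊆ P) : m'.Pa l ⊆ P := by
  rcases sameAt_or m m' l with hs | ⟨k, rfl, hk⟩ | ⟨k, rfl, hk⟩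
  · rw [hX.Pa_eq_of_sameAt hF hs, ← m.Top_leaf (hs.isLeaf_iff.2 hl)]
    exact h
  · exact absurd rfl (hl k)
  · rw [hX.Pa_leaf_eq hF hk, ← m.Top_leaf (hX.assigned hk).1]
    rw [m.Top_ctr, Finset.singleton_subset_iff] at h
    exact hP k h

theorem W_ne_zero {r : R} {k : K} (hk : k ∈ m'.Pa r) : W r k ≠ 0 := by
  have hp := hX.parallel hF
  rcases sameAt_or m m' r with hs | ⟨j, rfl, hj⟩ | ⟨j, rfl, hj⟩
  · rw [hX.Pa_eq_of_sameAt hF hs] at hk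
    exact hF.W_ne_zero hk
  · rw [hX.Pa_ctr_eq hF] at hk
    exact (hp j k).1 (hF.W_ne_zero hk)
  · rw [hX.Pa_leaf_eq hF hj] at hk
    exact (hp j k).2 (hF.W_ne_zero hk)

/-- `b1` for `m'` at a row that is a center of `m` and a leaf of `m'`. A spanning set `S` contains a
row `s` that involves the column `k`; such an `s` is a leaf of `m` with the parent `k`. In the linear
relation, `s` changes places with the row of the center, and `b1` of `m` is applied at `s`. -/
theorem b1_of_leaf {k : K} (hk : m'.ctr k ≠ m.ctr k) {S : Finset R}
    (hS : ∀ u ∈ S, m'.Poss (m.ctr k) u) (hc : S.card ≤ (m.Pa (m'.ctr k)).card)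
    (hs : rowOn W (m'.An (m.ctr k)) (m.ctr k) ∈ rowSpan W (m'.An (m.ctr k)) S) :
    S.card = (m.Pa (m'.ctr k)).card ∧ ∀ u ∈ S, m.Top u ⊆ m.Pa (m'.ctr k) := by
  have hp := hX.parallel hF
  have hA := hX.assigned hk
  have hleaf := hp.symm.isLeaf hk.symm
  obtain ⟨w, hw⟩ := mem_rowSpan_finset.1 hs
  have hwk := hw k ((mem_An_of_isLeaf hleaf).2 (m.W_ctr_self k))
  obtain ⟨s, hsS, hws⟩ := Finset.exists_ne_zero_of_sum_ne_zero (hwk ▸ m.W_ctr_self k)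
  have hsk := right_ne_zero_of_mul hws
  have hsupp : ∀ l, W s l ≠ 0 ↔ W (m.ctr k) l ≠ 0 := fun l =>
    ⟨fun hl => ((hS s hsS).2 l hl).1, fun hl => hF.trans _ _ _ hsk hl⟩
  have hsleaf : m.IsLeaf s := by
    rintro j rfl
    have := m.W_ctr_antisymm hsk ((hsupp j).1 (m.W_ctr_self j))
    exact (hS _ hsS).1 (by rw [this])
  have hQ : m'.An (m.ctr k) = m.An s := by
    ext l
    rw [mem_An_of_isLeaf hleaf, mem_An_of_isLeaf hsleaf, hsupp]
  have hks : k ∈ m.Pa s := by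
    obtain ⟨q, hq, hqk⟩ := exists_mem_Pa hsleaf hsk
    have := m.W_ctr_antisymm hqk ((hsupp q).1 (hF.W_ne_zero hq))
    exact this ▸ hq
  have hsub : m.Pa (m'.ctr k) ⊆ m.Pa s := by
    by_cases e : s = m'.ctr k
    · rw [e]
    · exact hA.2.2.2 s e hks
  have hspan : rowOn W (m.An s) s ∈
      rowSpan W (m.An s) (insert (m.ctr k) (S.erase s) : Finset R) := by
    rw [Finset.coe_insert, ← hQ]
    have : rowOn W (m'.An (m.ctr k)) s = (w s)⁻¹ • (rowOn W (m'.An (m.ctr k)) (m.ctr k) -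
        ∑ u ∈ S.erase s, w u • rowOn W (m'.An (m.ctr k)) u) := by
      ext l
      have := hw l l.2
      rw [← Finset.add_sum_erase _ _ hsS] at this
      simp only [rowOn, Pi.smul_apply, Pi.sub_apply, Finset.sum_apply, smul_eq_mul]
      rw [this, add_sub_cancel_right, ← mul_assoc, inv_mul_cancel₀ (left_ne_zero_of_mul hws),
        one_mul]
    rw [this]
    refine Submodule.smul_mem _ _ (Submodule.sub_mem _ (rowOn_mem_rowSpan (by simp)) ?_)
    exact Submodule.sum_mem _ fun u hu => Submodule.smul_mem _ _
      (rowOn_mem_rowSpan (Set.mem_insert_of_mem _ hu))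
  have hposs : ∀ u ∈ insert (m.ctr k) (S.erase s), m.Poss s u := by
    intro u hu
    rcases Finset.mem_insert.1 hu with rfl | hu
    · exact ⟨(hS s hsS).1.symm, fun l hl => hQ ▸ (mem_An_of_isLeaf hleaf).2 hl⟩
    · rw [Finset.mem_erase] at hu
      exact ⟨hu.1, fun l hl => hQ ▸ (hS u hu.2).2 l hl⟩
  have hcard : (insert (m.ctr k) (S.erase s)).card ≤ S.card := by
    refine (Finset.card_insert_le _ _).trans ?_
    rw [Finset.card_erase_add_one hsS]
  have h1 := hF.card_Pa_le hposs hspan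
  have h2 := Finset.card_le_card hsub
  have h3 := hF.Top_subset_of_b1 hposs (by omega) hspan
  have h4 := Finset.eq_of_subset_of_card_le hsub (by omega)
  refine ⟨by omega, fun u hu => ?_⟩
  rw [h4]
  by_cases hus : u = s
  · rw [hus, m.Top_leaf hsleaf]
  · exact h3 u (Finset.mem_insert_of_mem (Finset.mem_erase.2 ⟨hus, hu⟩))

theorem faithful : m'.Faithful where
  edge r k hk := hX.W_ne_zero hF (m'.mem_Pa.2 hk)
  trans r k l hr hl := hF.trans r k l hr ((hX.parallel hF k l).2 hl)
  b1 r S hS hc hs := by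
    have hp := hX.parallel hF
    rcases sameAt_or m m' r with hr | ⟨k, rfl, hk⟩ | ⟨k, rfl, hk⟩
    · rw [hX.Pa_eq_of_sameAt hF hr] at hc ⊢
      rw [← hr.An_eq] at hs
      have hS' : ∀ u ∈ S, m.Poss r u := fun u hu => hr.poss_iff.2 (hS u hu)
      refine ⟨(hF.b1 r S hS' hc hs).1, fun l hl hleaf => ?_⟩
      exact hX.Pa_subset_of_Top_subset hF (hX.closed_Pa r) hleaf
        (hF.Top_subset_of_b1 hS' hc hs l hl)
    · have hA := hX.assigned hk
      rw [hX.Pa_ctr_eq hF] at hc ⊢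
      rw [← hp.An_leaf hk] at hs
      have hS' : ∀ u ∈ S, m.Poss (m.ctr k) u := fun u hu => hp.poss_ctr_iff.2 (hS u hu)
      have hU := hA.card_union
      have h1 := hF.card_Pa_union_le hA.1 hA.2.1 hS' hs
      have h2 := hF.Top_subset_of_b2 hA.1 hA.2.1 hS' (by omega) hs
      refine ⟨by omega, fun l hl hleaf => ?_⟩
      refine hX.Pa_subset_of_Top_subset hF (hX.closed_Pa _) hleaf ?_
      rw [hA.union_erase] at h2
      exact h2 l hl
    · rw [hX.Pa_leaf_eq hF hk] at hc ⊢
      obtain ⟨h1, h2⟩ := hX.b1_of_leaf hF hk hS hc hs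
      exact ⟨h1, fun l hl hleaf =>
        hX.Pa_subset_of_Top_subset hF (hX.closed_Pa _) hleaf (h2 l hl)⟩
  b2 i hi k hk S hS hc hs := by
    have hp := hX.parallel hF
    have hS' : ∀ u ∈ S, m.Poss (m.ctr k) u := fun u hu => hp.poss_ctr_iff.2 (hS u hu)
    rw [hX.Pa_ctr_eq hF] at hc ⊢
    rcases sameAt_or m m' i with hr | ⟨q, rfl, hq⟩ | ⟨q, rfl, hq⟩
    · rw [hX.Pa_eq_of_sameAt hF hr] at hc hk ⊢
      rw [← hr.An_eq] at hs
      have hi' := hr.isLeaf_iff.2 hi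
      refine ⟨(hF.b2 i hi' k hk S hS' hc hs).1, fun l hl hleaf => ?_⟩
      refine hX.Pa_subset_of_Top_subset hF ?_ hleaf
        ((hF.Top_subset_of_b2 hi' hk hS' hc hs l hl).trans (Finset.erase_subset _ _))
      intro p hp
      rcases Finset.mem_union.1 hp with h | h
      · exact (hX.closed_Pa _ p h).trans Finset.subset_union_left
      · exact (hX.closed_Pa _ p h).trans Finset.subset_union_right
    · exact absurd rfl (hi q)
    · rw [hX.Pa_leaf_eq hF hq] at hc hk ⊢
      have hA := hX.assigned hq
      by_cases hkq : k = q
      · subst hkq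
        have hQ : m'.An (m.ctr k) \ {k} = m.An (m.ctr k) := by
          rw [hp.symm.An_leaf hq.symm]
        have hU := hA.card_union
        rw [hQ] at hs
        have h1 := hF.card_Pa_le hS' hs
        have h2 := hF.Top_subset_of_b1 hS' (by omega) hs
        refine ⟨by omega, fun l hl hleaf => ?_⟩
        exact (hX.Pa_subset_of_Top_subset hF (hX.closed_Pa _) hleaf (h2 l hl)).trans
          Finset.subset_union_left
      · -- `q` is not an ancestor of `k`, so the rows in `S` vanish at the column `q`
        exfalso
        have hqk : W (m.ctr q) k ≠ 0 := (hp q k).2 (hF.W_ne_zero hk)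
        obtain ⟨w, hw⟩ := mem_rowSpan_finset.1 hs
        have := hw q ⟨(mem_An_of_isLeaf hi).2 (m.W_ctr_self q), fun e => hkq e.symm⟩
        obtain ⟨u, hu, hwu⟩ := Finset.exists_ne_zero_of_sum_ne_zero (this ▸ m.W_ctr_self q)
        exact hkq (m.W_ctr_antisymm ((hS' u hu).2 q (right_ne_zero_of_mul hwu)).1 hqk)

end Exchanged

end Exchange

end Compare

variable {R K : Type*} [Fintype K] [DecidableEq R] [DecidableEq K] {W : R → K → ℝ}

/-! ### Groups -/

section Groups

variable (m : MixingRep W)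

/-- The group around the center of the column `k`. -/
def group (k : K) : Set R := {m.ctr k} ∪ {l | m.Assigned k l}

/-- The direct ordered groups. -/
def groups : Set (Set R) :=
  {G | ∃ k, G = m.group k} ∪ {G | ∃ l, m.IsLeaf l ∧ (∀ k, ¬ m.Assigned k l) ∧ G = {l}}

theorem ctr_mem_group (k : K) : m.ctr k ∈ m.group k := Or.inl rfl

theorem group_mem_groups (k : K) : m.group k ∈ m.groups := Or.inl ⟨k, rfl⟩

theorem exists_mem_groups (r : R) : ∃ G ∈ m.groups, r ∈ G := by
  by_cases h : ∃ k, m.Assigned k r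
  · obtain ⟨k, hk⟩ := h
    exact ⟨_, m.group_mem_groups k, Or.inr hk⟩
  rcases m.isLeaf_or r with hr | ⟨k, rfl⟩
  · exact ⟨{r}, Or.inr ⟨r, hr, not_exists.1 h, rfl⟩, rfl⟩
  · exact ⟨_, m.group_mem_groups k, m.ctr_mem_group k⟩

variable {m}

theorem ctr_mem_group_iff {k j : K} : m.ctr j ∈ m.group k ↔ j = k := by
  refine ⟨?_, fun h => h ▸ m.ctr_mem_group j⟩
  rintro (h | h)
  · exact m.ctr_inj h
  · exact absurd rfl (h.1 j)

theorem eq_group_of_ctr_mem {G : Set R} (hG : G ∈ m.groups) {k : K} (h : m.ctr k ∈ G) :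
    G = m.group k := by
  rcases hG with ⟨j, rfl⟩ | ⟨l, hl, -, rfl⟩
  · rw [ctr_mem_group_iff.1 h]
  · exact absurd (Set.mem_singleton_iff.1 h).symm (hl k)

theorem mem_group_iff {k : K} {r : R} : r ∈ m.group k ↔ r = m.ctr k ∨ m.Assigned k r := Iff.rfl

end Groups

variable {m m' : MixingRep W}

section Swap

variable (m m') in
open Classical in
/-- The map that interchanges the centers of corresponding columns. -/
def swap (r : R) : R :=
  if h : ∃ k, r = m.ctr k then m'.ctr h.choose
  else if h : ∃ k, r = m'.ctr k then m.ctr h.choose else r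

theorem swap_ctr (k : K) : swap m m' (m.ctr k) = m'.ctr k := by
  have h : ∃ j, m.ctr k = m.ctr j := ⟨k, rfl⟩
  rw [swap, dif_pos h, ← m.ctr_inj h.choose_spec]

theorem swap_of_sameAt {r : R} (hr : SameAt m m' r) : swap m m' r = r := by
  by_cases h : ∃ k, r = m.ctr k
  · obtain ⟨k, rfl⟩ := h
    rw [swap_ctr]
    exact ((hr k).1 rfl).symm
  · have h' : ¬ ∃ k, r = m'.ctr k := by simpa only [← hr _] using h
    rw [swap, dif_neg h, dif_neg h']

namespace Parallel

variable (h : Parallel m m')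
include h

theorem swap_ctr' (k : K) : swap m m' (m'.ctr k) = m.ctr k := by
  by_cases h1 : ∃ j, m'.ctr k = m.ctr j
  · obtain ⟨j, hj⟩ := h1
    have hkj := h.eq_of_ctr_eq hj
    subst hkj
    rw [hj, swap_ctr, hj]
  · have h2 : ∃ j, m'.ctr k = m'.ctr j := ⟨k, rfl⟩
    rw [swap, dif_neg h1, dif_pos h2, ← m'.ctr_inj h2.choose_spec]

theorem swap_involutive : Function.Involutive (swap m m') := by
  intro r
  rcases sameAt_or m m' r with hr | ⟨k, rfl, -⟩ | ⟨k, rfl, -⟩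
  · rw [swap_of_sameAt hr, swap_of_sameAt hr]
  · rw [h.swap_ctr', swap_ctr]
  · rw [swap_ctr, h.swap_ctr']

theorem swap_eq_ctr_iff {r : R} {k : K} : swap m m' r = m'.ctr k ↔ r = m.ctr k := by
  rw [← swap_ctr (m := m), h.swap_involutive.injective.eq_iff]

theorem isLeaf_swap {r : R} : m'.IsLeaf (swap m m' r) ↔ m.IsLeaf r := by
  simp only [IsLeaf, ne_eq, h.swap_eq_ctr_iff]

end Parallel

namespace Exchanged

variable (hF : m.Faithful) (hX : Exchanged m m')
include hF hX

/-- The interchange of the centers is an isomorphism of the causal diagrams. -/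
theorem Pa_swap (r : R) : m'.Pa (swap m m' r) = m.Pa r := by
  rcases sameAt_or m m' r with hr | ⟨k, rfl, hk⟩ | ⟨k, rfl, -⟩
  · rw [swap_of_sameAt hr, hX.Pa_eq_of_sameAt hF hr]
  · rw [(hX.parallel hF).swap_ctr', hX.Pa_leaf_eq hF hk]
  · rw [swap_ctr, hX.Pa_ctr_eq hF]

/-- This goes through the faithfulness of `m'`. -/
theorem symm : Exchanged m' m := (hX.faithful hF).eq_or_assigned hF

theorem assigned_swap {k : K} {l : R} (h : m.Assigned k l) : m'.Assigned k (swap m m' l) := by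
  have hp := hX.parallel hF
  refine ⟨hp.isLeaf_swap.2 h.1, ?_, ?_, fun r hr hk => ?_⟩
  · rw [hX.Pa_swap hF]
    exact h.2.1
  · rw [hX.Pa_swap hF, hX.Pa_ctr_eq hF]
    exact h.2.2.1
  · have hs := hp.swap_involutive r
    rw [← hs, hX.Pa_swap hF] at hk ⊢
    rw [hX.Pa_swap hF]
    refine h.2.2.2 _ (fun e => hr ?_) hk
    rw [← hs, e]

theorem group_subset (k : K) : m.group k ⊆ m'.group k := by
  rintro r (hr | hr)
  · rw [Set.mem_singleton_iff.1 hr]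
    rcases hX.symm hF k with h | h
    · exact Or.inl h
    · exact Or.inr h
  · rcases sameAt_or m m' r with hs | ⟨j, rfl, hj⟩ | ⟨j, rfl, -⟩
    · rw [← swap_of_sameAt hs]
      exact Or.inr (hX.assigned_swap hF hr)
    · rw [hr.unique (hX.assigned hj)]
      exact m'.ctr_mem_group j
    · exact absurd rfl (hr.1 j)

theorem group_eq (k : K) : m'.group k = m.group k :=
  ((hX.symm hF).group_subset (hX.faithful hF) k).antisymm (hX.group_subset hF k)

theorem groups_subset : m.groups ⊆ m'.groups := by
  rintro G (⟨k, rfl⟩ | ⟨l, hl, hlk, rfl⟩)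
  · exact Or.inl ⟨k, (hX.group_eq hF k).symm⟩
  · have hp := hX.parallel hF
    have hs : SameAt m m' l := by
      rcases sameAt_or m m' l with hs | ⟨j, rfl, hj⟩ | ⟨j, rfl, -⟩
      · exact hs
      · exact absurd (hX.assigned hj) (hlk j)
      · exact absurd rfl (hl j)
    refine Or.inr ⟨l, hs.isLeaf_iff.1 hl, fun k hk => hlk k ?_, rfl⟩
    rw [← swap_of_sameAt hs.symm]
    exact (hX.symm hF).assigned_swap (hX.faithful hF) hk

theorem groups_eq : m'.groups = m.groups :=
  ((hX.symm hF).groups_subset (hX.faithful hF)).antisymm (hX.groups_subset hF)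

theorem ctr_mem_group' (k : K) : m'.ctr k ∈ m.group k := by
  rw [← hX.group_eq hF]
  exact m'.ctr_mem_group k

theorem exists_group_swap (r : R) : ∃ G ∈ m.groups, r ∈ G ∧ swap m m' r ∈ G := by
  rcases sameAt_or m m' r with hs | ⟨k, rfl, -⟩ | ⟨k, rfl, -⟩
  · obtain ⟨G, hG, hr⟩ := m.exists_mem_groups r
    exact ⟨G, hG, hr, (swap_of_sameAt hs).symm ▸ hr⟩
  · rw [(hX.parallel hF).swap_ctr']
    exact ⟨_, m.group_mem_groups k, hX.ctr_mem_group' hF k, m.ctr_mem_group k⟩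
  · rw [swap_ctr]
    exact ⟨_, m.group_mem_groups k, m.ctr_mem_group k, hX.ctr_mem_group' hF k⟩

end Exchanged

theorem W_ne_zero_of_mem_group (hF : m.Faithful) {k : K} {r : R} (h : r ∈ m.group k) (l : K) :
    W (m.ctr k) l ≠ 0 ↔ W r l ≠ 0 := by
  rcases h with h | h
  · rw [Set.mem_singleton_iff.1 h]
  · exact h.W_ne_zero_iff hF l

/-- If each group of `m` contains a center of `m'`, then this is the center of the same column: the
column `f k` of the center of `m'` in the group of `k` is `k` or precedes it in the causal order, and
`f` is injective, so `f` is the identity. -/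
theorem exchanged_of_forall_exists (hF : m.Faithful) (h : ∀ k, ∃ j, m'.ctr j ∈ m.group k) :
    Exchanged m m' := by
  choose f hf using h
  have hinj : Function.Injective f := by
    intro k l hkl
    have hk := W_ne_zero_of_mem_group hF (hf k)
    have hl := W_ne_zero_of_mem_group hF (hf l)
    rw [hkl] at hk
    exact m.W_ctr_antisymm ((hk l).2 ((hl l).1 (m.W_ctr_self l)))
      ((hl k).2 ((hk k).1 (m.W_ctr_self k)))
  have hf' : ∀ k, f k = k := by
    intro k
    induction hn : m.o k using Nat.strong_induction_on generalizing k with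
    | _ n ih =>
      subst hn
      rcases m.W_ctr_ne_zero ((W_ne_zero_of_mem_group hF (hf k) (f k)).2
        (m'.W_ctr_self (f k))) with h | h
      · exact h
      · exact hinj (ih _ h _ rfl)
  intro k
  have := hf k
  rw [hf' k] at this
  exact this

end Swap

end MixingRep

/-! ### Total effects and the mixing matrix of an SEM-ME -/

theorem Matrix.geom_sum_eq_mul_add_one {n : Type*} [Fintype n] [DecidableEq n] {A : Matrix n n ℝ}
    {N : ℕ} (h : A ^ N = 0) :
    ∑ k ∈ Finset.range N, A ^ k = A * ∑ k ∈ Finset.range N, A ^ k + 1 := by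
  have := Finset.sum_range_succ (fun k => A ^ k) N
  rw [h, add_zero, Finset.sum_range_succ'] at this
  rw [Finset.mul_sum, ← this, pow_zero]
  simp only [pow_succ']

namespace SEMME

section TotalEffect

variable {V : Type*} [Fintype V] [DecidableEq V] {Y : Set V} (M : SEMME V Y)

/-- A path with `k` edges that ends in `v` needs at least `k` variables before `v`. -/
theorem coef_pow_card : M.coef ^ Fintype.card V = 0 := by
  obtain ⟨o, -, ho⟩ := M.causalOrder
  have key : ∀ (k : ℕ) (v u : V), (M.coef ^ k) v u ≠ 0 →
      k ≤ (Finset.univ.filter fun w => o w < o v).card := by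
    intro k
    induction k with
    | zero => simp
    | succ k ih =>
      intro v u h
      rw [pow_succ', Matrix.mul_apply] at h
      obtain ⟨w, -, hw⟩ := Finset.exists_ne_zero_of_sum_ne_zero h
      have hwv := ho v w (left_ne_zero_of_mul hw)
      refine (Nat.succ_le_succ (ih w u (right_ne_zero_of_mul hw))).trans
        (Finset.card_lt_card ?_)
      refine ⟨fun x => ?_, fun hsub => ?_⟩
      · simp only [Finset.mem_filter, Finset.mem_univ, true_and]
        exact fun h => h.trans hwv
      · have := @hsub w (by simpa using hwv)
        simp at this
  ext v u
  by_contra h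
  refine (key _ v u h).not_gt ?_
  rw [← Finset.card_univ]
  refine Finset.card_lt_card ⟨Finset.subset_univ _, fun h => ?_⟩
  have := h (Finset.mem_univ v)
  simp at this

theorem TE_eq (u v : V) :
    M.TE u v = ∑ w, M.coef v w * M.TE u w + if v = u then 1 else 0 := by
  have h' := congrFun (congrFun (Matrix.geom_sum_eq_mul_add_one M.coef_pow_card) v) u
  rw [Matrix.add_apply, Matrix.mul_apply, Matrix.one_apply] at h'
  simpa only [TE, Matrix.sum_apply] using h'

theorem reflTransGen_of_TE_ne_zero {u v : V} (h : M.TE u v ≠ 0) :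
    Relation.ReflTransGen (fun a b => M.coef b a ≠ 0) u v := by
  obtain ⟨k, -, hk⟩ := Finset.exists_ne_zero_of_sum_ne_zero h
  clear h
  induction k generalizing v with
  | zero =>
    have : v = u := by
      by_contra hne
      exact hk (by rw [pow_zero, Matrix.one_apply_ne hne])
    rw [this]
  | succ k ih =>
    rw [pow_succ', Matrix.mul_apply] at hk
    obtain ⟨w, -, hw⟩ := Finset.exists_ne_zero_of_sum_ne_zero hk
    exact (ih (right_ne_zero_of_mul hw)).tail (left_ne_zero_of_mul hw)

theorem notMem_An_self (v : V) : v ∉ M.An v := by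
  obtain ⟨o, -, ho⟩ := M.causalOrder
  have key : ∀ {u w : V}, Relation.TransGen (fun a b => M.coef b a ≠ 0) u w → o u < o w := by
    intro u w h
    induction h with
    | single h => exact ho _ _ h
    | tail _ h ih => exact ih.trans (ho _ _ h)
  exact fun h => lt_irrefl _ (key h)

theorem not_isULeaf_of_coef {v w : V} (h : M.coef w v ≠ 0) : ¬ M.IsULeaf v := fun hv => by
  have : w ∈ M.Ch v := h
  rw [hv.2] at this
  exact this

theorem mixing_eq_TE (v : V) (j : M.NU) : M.mixing v j = M.TE j v := by
  classical
  have hsum : ∀ v u, ∑ w, M.coef v w * M.TE u w = ∑ w : M.NU, M.coef v w * M.TE u w := by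
    intro v u
    refine (Finset.sum_of_injOn Subtype.val Subtype.val_injective.injOn (by simp) ?_ ?_).symm
    · intro w _ hw
      have : M.coef v w = 0 := by
        by_contra h
        exact hw ⟨⟨w, M.not_isULeaf_of_coef h⟩, by simp, rfl⟩
      rw [this, zero_mul]
    · simp
  have hinv : (1 - M.coefC)⁻¹ = Matrix.of fun i j : M.NU => M.TE j i := by
    refine Matrix.inv_eq_right_inv ?_
    ext i j
    rw [Matrix.sub_mul, one_mul, Matrix.sub_apply, Matrix.mul_apply, Matrix.one_apply,
      Matrix.of_apply, M.TE_eq, hsum]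
    simp [coefC, Subtype.ext_iff]
  unfold mixing
  split_ifs with h
  · have hvj : v ≠ j := fun e => j.2 (e ▸ h)
    rw [M.TE_eq, if_neg hvj, hsum, add_zero, Matrix.mul_apply]
    refine Finset.sum_congr rfl fun w _ => congrArg (M.coef v w * ·) ?_
    have := congrFun (congrFun hinv w) j
    rw [Matrix.of_apply] at this
    convert this
  · have := congrFun (congrFun hinv ⟨v, h⟩) j
    rw [Matrix.of_apply] at this
    convert this

end TotalEffect

/-! ### From an SEM-ME to a representation of its mixing matrix -/

/-- A labelling of the variables of `M` by `R` and of its nu-leaves by `K`, for which the total effects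
are the entries of `W` up to row and column scaling. -/
structure Indexing {V R K : Type*} [Fintype V] [DecidableEq V] {Y : Set V} (M : SEMME V Y)
    (W : R → K → ℝ) where
  row : R ≃ V
  col : K → V
  col_inj : Function.Injective col
  not_isULeaf_iff : ∀ v, ¬ M.IsULeaf v ↔ ∃ k, col k = v
  a : R → ℝ
  b : K → ℝ
  a_ne : ∀ r, a r ≠ 0
  b_ne : ∀ k, b k ≠ 0
  TE_eq : ∀ r k, M.TE (col k) (row r) = a r * b k * W r k

namespace Indexing

variable {V R K : Type*} [Fintype V] [DecidableEq V] {Y : Set V} {M : SEMME V Y}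
  [Fintype K] [DecidableEq R] [DecidableEq K] {W : R → K → ℝ} (I : Indexing M W)

theorem exists_col {v w : V} (h : M.coef w v ≠ 0) : ∃ k, I.col k = v :=
  (I.not_isULeaf_iff v).1 (M.not_isULeaf_of_coef h)

/-- The representation of `W` given by `M`; the scaling of the rows is absorbed into the coefficients,
that of the columns into the noise terms. -/
def rep : MixingRep W where
  ctr k := I.row.symm (I.col k)
  ctr_inj := I.row.symm.injective.comp I.col_inj
  E r l := M.coef (I.row r) (I.col l) * I.a (I.row.symm (I.col l)) / I.a r
  scale k := (I.a (I.row.symm (I.col k)) * I.b k)⁻¹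
  scale_ne k := inv_ne_zero (mul_ne_zero (I.a_ne _) (I.b_ne _))
  eqn r k := by
    have h := M.TE_eq (I.col k) (I.row r)
    have hsum : ∑ w, M.coef (I.row r) w * M.TE (I.col k) w =
        ∑ l, M.coef (I.row r) (I.col l) *
          (I.a (I.row.symm (I.col l)) * I.b k * W (I.row.symm (I.col l)) k) := by
      symm
      refine Finset.sum_of_injOn I.col I.col_inj.injOn (by simp) ?_ ?_
      · intro w _ hw
        have : M.coef (I.row r) w = 0 := by
          by_contra h
          obtain ⟨k, hk⟩ := I.exists_col h
          exact hw ⟨k, by simp, hk⟩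
        rw [this, zero_mul]
      · intro l _
        rw [← I.TE_eq, Equiv.apply_symm_apply]
    rw [hsum, I.TE_eq] at h
    have ha := I.a_ne r
    have hb := I.b_ne k
    have h' : W r k = (I.a r * I.b k)⁻¹ * (I.a r * I.b k * W r k) := by
      field_simp
    rw [h', h, mul_add, Finset.mul_sum]
    congr 1
    · refine Finset.sum_congr rfl fun l _ => ?_
      field_simp
    · by_cases e : r = I.row.symm (I.col k)
      · rw [if_pos e, if_pos ((Equiv.eq_symm_apply _).1 e), mul_one, e]
      · rw [if_neg e, if_neg (fun e' => e ((Equiv.eq_symm_apply _).2 e')), mul_zero]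
  o k := M.causalOrder.choose (I.col k)
  order k l h := by
    refine M.causalOrder.choose_spec.2 _ _ ?_
    have := left_ne_zero_of_mul (left_ne_zero_of_mul h)
    rwa [Equiv.apply_symm_apply] at this

theorem row_ctr (k : K) : I.row (I.rep.ctr k) = I.col k := I.row.apply_symm_apply _

theorem eq_ctr_iff {r : R} {k : K} : r = I.rep.ctr k ↔ I.row r = I.col k :=
  Equiv.eq_symm_apply _

theorem E_ne_zero_iff {r : R} {k : K} : I.rep.E r k ≠ 0 ↔ M.coef (I.row r) (I.col k) ≠ 0 := by
  simp [rep, I.a_ne]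

theorem mem_Pa_iff {r : R} {k : K} : k ∈ I.rep.Pa r ↔ I.col k ∈ M.Pa (I.row r) := by
  rw [MixingRep.mem_Pa, E_ne_zero_iff]
  rfl

theorem TE_ne_zero_iff {r : R} {k : K} : M.TE (I.col k) (I.row r) ≠ 0 ↔ W r k ≠ 0 := by
  simp [I.TE_eq, I.a_ne, I.b_ne]

theorem Pa_eq (r : R) : M.Pa (I.row r) = I.col '' (I.rep.Pa r) := by
  ext v
  constructor
  · intro hv
    obtain ⟨k, rfl⟩ := I.exists_col hv
    exact ⟨k, I.mem_Pa_iff.2 hv, rfl⟩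
  · rintro ⟨k, hk, rfl⟩
    exact I.mem_Pa_iff.1 hk

theorem isLeaf_iff {r : R} : I.rep.IsLeaf r ↔ M.IsULeaf (I.row r) := by
  rw [← not_iff_not, I.not_isULeaf_iff]
  simp [MixingRep.IsLeaf, I.eq_ctr_iff, eq_comm]

/-- Part (a) for edges and its inheritance by concatenated paths give part (a) for all paths. -/
theorem faithfulA_iff : M.FaithfulA ↔ (∀ r k, I.rep.E r k ≠ 0 → W r k ≠ 0) ∧
    ∀ r k l, W r k ≠ 0 → W (I.rep.ctr k) l ≠ 0 → W r l ≠ 0 := by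
  constructor
  · intro hA
    refine ⟨fun r k h => ?_, fun r k l h h' => ?_⟩
    · exact I.TE_ne_zero_iff.1 (hA _ _ (.single (I.E_ne_zero_iff.1 h)))
    · rw [← I.TE_ne_zero_iff] at h h'
      rw [row_ctr] at h'
      have := (M.reflTransGen_of_TE_ne_zero h').trans (M.reflTransGen_of_TE_ne_zero h)
      rcases Relation.reflTransGen_iff_eq_or_transGen.1 this with e | e
      · rw [I.eq_ctr_iff.2 e]
        exact I.rep.W_ctr_self l
      · exact I.TE_ne_zero_iff.1 (hA _ _ e)
  · rintro ⟨h1, h2⟩ u v h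
    have hE : ∀ {k v}, M.coef v (I.col k) ≠ 0 → W (I.row.symm v) k ≠ 0 := by
      intro k v h
      exact h1 _ _ (I.E_ne_zero_iff.2 (by rwa [Equiv.apply_symm_apply]))
    obtain ⟨k, rfl⟩ : ∃ k, I.col k = u := by
      obtain ⟨w, hw, -⟩ := Relation.TransGen.head'_iff.1 h
      exact I.exists_col hw
    rw [← I.row.apply_symm_apply v, I.TE_ne_zero_iff]
    induction h with
    | single h => exact hE h
    | tail _ h ih =>
      obtain ⟨j, rfl⟩ := I.exists_col h
      exact h2 _ _ _ (hE h) ih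

theorem An_eq (hA : M.FaithfulA) (r : R) : M.An (I.row r) = I.col '' (I.rep.An r) := by
  ext v
  constructor
  · intro hv
    obtain ⟨k, rfl⟩ : ∃ k, I.col k = v := by
      obtain ⟨w, hw, -⟩ := Relation.TransGen.head'_iff.1 hv
      exact I.exists_col hw
    refine ⟨k, ⟨I.TE_ne_zero_iff.1 (hA _ _ hv), fun e => ?_⟩, rfl⟩
    rw [I.eq_ctr_iff.1 e] at hv
    exact M.notMem_An_self _ hv
  · rintro ⟨k, ⟨hk, hne⟩, rfl⟩
    rcases Relation.reflTransGen_iff_eq_or_transGen.1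
      (M.reflTransGen_of_TE_ne_zero (I.TE_ne_zero_iff.2 hk)) with e | e
    · exact absurd (I.eq_ctr_iff.2 e) hne
    · exact e

theorem mem_An_iff (hA : M.FaithfulA) {r : R} {k : K} :
    I.col k ∈ M.An (I.row r) ↔ k ∈ I.rep.An r := by
  rw [I.An_eq hA, I.col_inj.mem_set_image]

theorem mem_PossPa_iff (hA : M.FaithfulA) {r u : R} :
    I.row u ∈ M.PossPa (I.row r) ↔ I.rep.Poss r u := by
  obtain ⟨h1, h2⟩ := I.faithfulA_iff.1 hA
  have hstep : ∀ {q k : K}, q ∈ I.rep.An r → W (I.rep.ctr q) k ≠ 0 → k ∈ I.rep.An r := by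
    intro q k hq h
    refine ⟨h2 r q k hq.1 h, ?_⟩
    rintro rfl
    exact hq.2 (by rw [I.rep.W_ctr_antisymm h hq.1])
  unfold PossPa MixingRep.Poss
  rw [Set.mem_ofPred_eq, I.row.injective.ne_iff]
  refine and_congr_right fun _ => ⟨?_, fun h => ?_⟩
  · rintro (h | ⟨hl, h⟩) k hk
    · rw [I.An_eq hA] at h
      obtain ⟨q, hq, e⟩ := h
      rw [I.eq_ctr_iff.2 e.symm] at hk
      exact hstep hq hk
    · obtain ⟨q, hq, hqk⟩ := MixingRep.exists_mem_Pa (I.isLeaf_iff.2 hl) hk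
      exact hstep ((I.mem_An_iff hA).1 (h (I.mem_Pa_iff.1 hq))) hqk
  · rcases I.rep.isLeaf_or u with hu | ⟨k, rfl⟩
    · refine Or.inr ⟨I.isLeaf_iff.1 hu, ?_⟩
      rw [I.Pa_eq, I.An_eq hA]
      exact Set.image_mono fun k hk => h k (h1 _ _ (I.rep.mem_Pa.1 hk))
    · left
      rw [row_ctr, I.mem_An_iff hA]
      exact h k (I.rep.W_ctr_self k)

/-- The scaling of the rows changes the coefficients of a linear combination, that of the columns
cancels. -/
theorem mem_span_iff {T : Set V} {Q : Set K} (hT : T = I.col '' Q) {S : Finset R} {r : R} :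
    M.TEvec T (I.row r) ∈
      Submodule.span ℝ (M.TEvec T '' ((S.map I.row.toEmbedding : Finset V) : Set V)) ↔
    rowOn W Q r ∈ rowSpan W Q S := by
  rw [Submodule.mem_span_image_finset_iff_exists_fun', mem_rowSpan_finset]
  have hsum : ∀ (w : V → ℝ) (k : K),
      ∑ u ∈ S.map I.row.toEmbedding, w u * M.TE (I.col k) u =
        ∑ u ∈ S, w (I.row u) * (I.a u * I.b k * W u k) := by
    intro w k
    simp [Finset.sum_map, I.TE_eq]
  have ha := I.a_ne
  have hb := I.b_ne
  constructor
  · rintro ⟨w, hw⟩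
    refine ⟨fun u => w (I.row u) * I.a u / I.a r, fun k hk => ?_⟩
    have := congrFun hw ⟨I.col k, hT ▸ Set.mem_image_of_mem _ hk⟩
    simp only [Finset.sum_apply, Pi.smul_apply, smul_eq_mul, TEvec] at this
    rw [hsum, I.TE_eq] at this
    refine mul_left_cancel₀ (mul_ne_zero (ha r) (hb k)) ?_
    rw [← this, Finset.mul_sum]
    refine Finset.sum_congr rfl fun u _ => ?_
    have := ha r
    field_simp
  · rintro ⟨w, hw⟩
    refine ⟨fun v => w (I.row.symm v) * I.a r / I.a (I.row.symm v), ?_⟩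
    ext ⟨v, hv⟩
    subst hT
    obtain ⟨k, hk, rfl⟩ := hv
    simp only [Finset.sum_apply, Pi.smul_apply, smul_eq_mul, TEvec]
    rw [hsum, I.TE_eq, hw k hk, Finset.mul_sum]
    refine Finset.sum_congr rfl fun u _ => ?_
    have := ha u
    rw [Equiv.symm_apply_apply]
    field_simp

theorem ncard_image (P : Finset K) : (I.col '' (P : Set K)).ncard = P.card := by
  rw [Set.ncard_image_of_injective _ I.col_inj, Set.ncard_coe_finset]

theorem Pa_union_eq (r u : R) :
    M.Pa (I.row r) ∪ M.Pa (I.row u) = I.col '' ((I.rep.Pa r ∪ I.rep.Pa u : Finset K) : Set K) := by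
  rw [Finset.coe_union, Set.image_union, Pa_eq, Pa_eq]

theorem image_subset_iff {P P' : Finset K} :
    I.col '' (P : Set K) ⊆ I.col '' (P' : Set K) ↔ P ⊆ P' := by
  rw [Set.image_subset_image_iff I.col_inj, Finset.coe_subset]

theorem forall_finset {p : Finset V → Prop} :
    (∀ S, p S) ↔ ∀ S : Finset R, p (S.map I.row.toEmbedding) :=
  (I.row.finsetCongr.forall_congr_right (q := p)).symm

theorem faithfulB1_iff (hA : M.FaithfulA) : M.FaithfulB1 ↔
    ∀ (r : R) (S : Finset R), (∀ u ∈ S, I.rep.Poss r u) → S.card ≤ (I.rep.Pa r).card →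
      rowOn W (I.rep.An r) r ∈ rowSpan W (I.rep.An r) S →
      S.card = (I.rep.Pa r).card ∧ ∀ l ∈ S, I.rep.IsLeaf l → I.rep.Pa l ⊆ I.rep.Pa r := by
  unfold FaithfulB1
  rw [← I.row.forall_congr_right]
  refine forall_congr' fun r => ?_
  rw [I.forall_finset]
  refine forall_congr' fun S => ?_
  rw [I.mem_span_iff (I.An_eq hA r)]
  simp only [Finset.forall_mem_map, Equiv.coe_toEmbedding, I.mem_PossPa_iff hA, I.Pa_eq,
    I.ncard_image, Finset.card_map, ← I.isLeaf_iff, I.image_subset_iff]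

theorem faithfulB2_iff (hA : M.FaithfulA) : M.FaithfulB2 ↔
    ∀ i, I.rep.IsLeaf i → ∀ j ∈ I.rep.Pa i, ∀ S : Finset R,
      (∀ u ∈ S, I.rep.Poss (I.rep.ctr j) u) →
      S.card + 1 ≤ (I.rep.Pa (I.rep.ctr j) ∪ I.rep.Pa i).card →
      rowOn W (I.rep.An i \ {j}) i ∈ rowSpan W (I.rep.An i \ {j}) S →
      S.card + 1 = (I.rep.Pa (I.rep.ctr j) ∪ I.rep.Pa i).card ∧
        ∀ l ∈ S, I.rep.IsLeaf l → I.rep.Pa l ⊆ I.rep.Pa (I.rep.ctr j) ∪ I.rep.Pa i := by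
  unfold FaithfulB2
  rw [← I.row.forall_congr_right]
  refine forall_congr' fun i => ?_
  rw [I.isLeaf_iff, I.Pa_eq, Set.forall_mem_image]
  refine forall_congr' fun _ => forall₂_congr fun j _ => ?_
  rw [I.forall_finset]
  refine forall_congr' fun S => ?_
  have hT : M.An (I.row i) \ {I.col j} = I.col '' (I.rep.An i \ {j}) := by
    rw [Set.image_sdiff I.col_inj, I.An_eq hA, Set.image_singleton]
  rw [I.mem_span_iff hT, ← I.row_ctr j, ← I.Pa_eq, I.Pa_union_eq]
  simp only [Finset.forall_mem_map, Equiv.coe_toEmbedding, I.mem_PossPa_iff hA, I.Pa_eq,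
    I.ncard_image, Finset.card_map, ← I.isLeaf_iff, I.image_subset_iff]

theorem faithful_iff : M.Faithful ↔ I.rep.Faithful := by
  constructor
  · rintro ⟨hA, h1, h2⟩
    exact ⟨(I.faithfulA_iff.1 hA).1, (I.faithfulA_iff.1 hA).2, (I.faithfulB1_iff hA).1 h1,
      (I.faithfulB2_iff hA).1 h2⟩
  · intro hF
    have hA := I.faithfulA_iff.2 ⟨hF.edge, hF.trans⟩
    exact ⟨hA, (I.faithfulB1_iff hA).2 hF.b1, (I.faithfulB2_iff hA).2 hF.b2⟩

theorem assigned_iff {k : K} {l : R} :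
    M.Assigned (I.col k) (I.row l) ↔ I.rep.Assigned k l := by
  unfold Assigned MixingRep.Assigned EdgeIdent
  rw [I.isLeaf_iff, I.mem_Pa_iff, not_or, not_not, not_not]
  refine and_congr_right fun _ => and_congr_right fun _ => and_congr ?_ ?_
  · rw [← I.row_ctr, I.Pa_eq, I.Pa_eq, row_ctr, ← Set.image_singleton, ← Set.image_sdiff I.col_inj,
      ← Finset.coe_erase, I.image_subset_iff]
  · rw [Set.subset_iInter₂_iff, ← I.row.forall_congr_right]
    refine forall_congr' fun r => ?_
    have : I.row r ∈ M.Ch (I.col k) \ {I.row l} ↔ r ≠ l ∧ k ∈ I.rep.Pa r := by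
      rw [Set.mem_sdiff, Set.mem_singleton_iff, I.row.injective.eq_iff, I.mem_Pa_iff, and_comm]
      rfl
    rw [this, and_imp, I.Pa_eq, I.Pa_eq, I.image_subset_iff]

theorem DOG_eq : M.DOG = (fun G => I.row '' G) '' I.rep.groups := by
  have hgroup : ∀ k, I.row '' I.rep.group k = {I.col k} ∪ {l | M.Assigned (I.col k) l} := by
    intro k
    ext v
    obtain ⟨r, rfl⟩ := I.row.surjective v
    rw [I.row.injective.mem_set_image, MixingRep.mem_group_iff, I.eq_ctr_iff, ← I.assigned_iff]
    rfl
  have hno : ∀ l, (∀ i, ¬ M.Assigned i (I.row l)) ↔ ∀ k, ¬ I.rep.Assigned k l := by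
    intro l
    refine ⟨fun h k hk => h _ (I.assigned_iff.2 hk), fun h i hi => ?_⟩
    obtain ⟨k, rfl⟩ := I.exists_col hi.2.1
    exact h k (I.assigned_iff.1 hi)
  unfold DOG MixingRep.groups
  rw [Set.image_union]
  congr 1
  · ext G
    constructor
    · rintro ⟨i, hi, rfl⟩
      obtain ⟨k, rfl⟩ := (I.not_isULeaf_iff i).1 hi
      exact ⟨_, ⟨k, rfl⟩, hgroup k⟩
    · rintro ⟨_, ⟨k, rfl⟩, rfl⟩
      exact ⟨_, (I.not_isULeaf_iff _).2 ⟨k, rfl⟩, hgroup k⟩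
  · ext G
    constructor
    · rintro ⟨v, hv, h, rfl⟩
      obtain ⟨l, rfl⟩ := I.row.surjective v
      exact ⟨{l}, ⟨l, I.isLeaf_iff.2 hv, (hno l).1 h, rfl⟩, Set.image_singleton⟩
    · rintro ⟨_, ⟨l, hl, h, rfl⟩, rfl⟩
      exact ⟨_, I.isLeaf_iff.1 hl, (hno l).2 h, Set.image_singleton⟩

end Indexing

end SEMME

/-! ### Identification of an SEM-ME -/

namespace SEMME

variable {V : Type*} [Fintype V] [DecidableEq V] {Y : Set V} {M M' : SEMME V Y}

variable (M) in
/-- The columns of the mixing matrix are labelled by the nu-leaves themselves. -/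
def indexingSelf : Indexing M M.mixing where
  row := Equiv.refl V
  col := Subtype.val
  col_inj := Subtype.val_injective
  not_isULeaf_iff v := ⟨fun h => ⟨⟨v, h⟩, rfl⟩, by rintro ⟨k, rfl⟩; exact k.2⟩
  a _ := 1
  b _ := 1
  a_ne _ := one_ne_zero
  b_ne _ := one_ne_zero
  TE_eq r k := by rw [mixing_eq_TE, one_mul, one_mul]; rfl

/-- The mixing matrix of `M` as that of `M'`, whose nu-leaves are labelled by those of `M`. -/
def indexingOfMixing (π : M.NU ≃ M'.NU) (s : M.NU → ℝ) (hs : ∀ j, s j ≠ 0)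
    (h : ∀ v j, M'.mixing v (π j) = s j * M.mixing v j) : Indexing M' M.mixing where
  row := Equiv.refl V
  col k := (π k).1
  col_inj := Subtype.val_injective.comp π.injective
  not_isULeaf_iff v := by
    refine ⟨fun h => ⟨π.symm ⟨v, h⟩, by rw [Equiv.apply_symm_apply]⟩, ?_⟩
    rintro ⟨k, rfl⟩
    exact (π k).2
  a _ := 1
  b := s
  a_ne _ := one_ne_zero
  b_ne := hs
  TE_eq r k := by rw [one_mul, ← h, mixing_eq_TE]; rfl

theorem exists_indexing (h : SameMixing M M') :
    ∃ I : Indexing M' M.mixing, I.row = Equiv.refl V := by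
  obtain ⟨π, s, hs, h⟩ := h
  exact ⟨indexingOfMixing π s hs h, rfl⟩

section

variable {I' : Indexing M' M.mixing} (hI : I'.row = Equiv.refl V)
include hI

theorem sameEdges_of_exchanged (hF : M.indexingSelf.rep.Faithful)
    (hX : MixingRep.Exchanged M.indexingSelf.rep I'.rep) : SameEdges M M' := by
  have hp := hX.parallel hF
  have hleaf : ∀ v, I'.rep.IsLeaf v ↔ M'.IsULeaf v := by
    intro v
    rw [I'.isLeaf_iff, hI, Equiv.refl_apply]
  have hleafM : ∀ v, M.indexingSelf.rep.IsLeaf v ↔ M.IsULeaf v := fun v =>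
    M.indexingSelf.isLeaf_iff
  have hctr : ∀ k, I'.rep.ctr k = I'.col k := by
    intro k
    have := I'.row_ctr k
    rwa [hI, Equiv.refl_apply] at this
  let σ : Equiv.Perm V :=
    Function.Involutive.toPerm (MixingRep.swap M.indexingSelf.rep I'.rep) hp.swap_involutive
  refine ⟨σ, fun v => ?_, fun v => ?_, fun v hv => ?_, fun u v => ?_⟩
  · obtain ⟨G, hG, h⟩ := hX.exists_group_swap hF v
    refine ⟨G, ?_, h⟩
    rw [M.indexingSelf.DOG_eq]
    exact ⟨G, hG, Set.image_id G⟩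
  · rw [← hleaf, ← hleafM]
    exact (hp.isLeaf_swap (r := v)).symm
  · rw [← hleaf, ← hleafM] at hv
    refine MixingRep.swap_of_sameAt (m := M.indexingSelf.rep) (m' := I'.rep) ?_
    rcases MixingRep.sameAt_or M.indexingSelf.rep I'.rep v with h | ⟨k, rfl, hk⟩ | ⟨k, rfl, hk⟩
    · exact h
    · exact absurd (hv.1 (hp.isLeaf hk)) (I'.rep.not_isLeaf_ctr k)
    · exact absurd (hv.2 (hp.symm.isLeaf hk.symm)) (M.indexingSelf.rep.not_isLeaf_ctr k)
  · have hPa : ∀ k, I'.col k ∈ M'.Pa (σ v) ↔ k.1 ∈ M.Pa v := by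
      intro k
      have h1 := I'.mem_Pa_iff (r := MixingRep.swap M.indexingSelf.rep I'.rep v) (k := k)
      rw [hX.Pa_swap hF, M.indexingSelf.mem_Pa_iff, hI] at h1
      exact h1.symm
    constructor
    · intro h
      obtain ⟨k, rfl⟩ : ∃ k : M.NU, k.1 = u := ⟨⟨u, M.not_isULeaf_of_coef h⟩, rfl⟩
      have : σ k.1 = I'.col k := by
        rw [← hctr]
        exact MixingRep.swap_ctr (m := M.indexingSelf.rep) (m' := I'.rep) k
      rw [this]
      exact (hPa k).2 h
    · intro h
      obtain ⟨k, hk⟩ := I'.exists_col h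
      have : u = k.1 := hp.swap_eq_ctr_iff.1 (hk.symm.trans (hctr k).symm)
      rw [this]
      rw [← hk] at h
      exact (hPa k).1 h

theorem exchanged_of_dogEquiv (hF : M.indexingSelf.rep.Faithful) (h : DOGEquiv M M') :
    MixingRep.Exchanged M.indexingSelf.rep I'.rep := by
  refine MixingRep.exchanged_of_forall_exists hF fun k => ?_
  have hG : M.indexingSelf.rep.group k ∈ M.DOG := by
    rw [M.indexingSelf.DOG_eq]
    exact ⟨_, M.indexingSelf.rep.group_mem_groups k, Set.image_id _⟩
  obtain ⟨v, hv, hv'⟩ := (h.2.2 _ hG).1 ⟨_, M.indexingSelf.rep.ctr_mem_group k, k.2⟩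
  obtain ⟨j, hj⟩ := (I'.not_isULeaf_iff v).1 hv'
  refine ⟨j, ?_⟩
  have h1 := I'.row_ctr j
  rw [hI, Equiv.refl_apply] at h1
  rwa [h1, hj]

theorem dogEquiv_of_exchanged (hm : SameMixing M M') (hF : M.indexingSelf.rep.Faithful)
    (hX : MixingRep.Exchanged M.indexingSelf.rep I'.rep) : DOGEquiv M M' := by
  have hD : M.DOG = M.indexingSelf.rep.groups := by
    rw [M.indexingSelf.DOG_eq]
    exact (Set.image_congr fun G _ => Set.image_id G).trans (Set.image_id _)
  have hctr : ∀ k, I'.rep.ctr k = I'.col k := by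
    intro k
    have := I'.row_ctr k
    rwa [hI, Equiv.refl_apply] at this
  have hD' : M'.DOG = I'.rep.groups := by
    rw [I'.DOG_eq, hI]
    exact (Set.image_congr fun G _ => Set.image_id G).trans (Set.image_id _)
  have hg := hX.groups_eq hF
  refine ⟨hm, by rw [hD, hD', hg], fun G hG => ?_⟩
  rw [hD] at hG
  constructor
  · rintro ⟨v, hvG, hv⟩
    have := MixingRep.eq_group_of_ctr_mem hG (k := (⟨v, hv⟩ : M.NU)) hvG
    rw [this]
    exact ⟨_, hX.ctr_mem_group' hF _, (I'.not_isULeaf_iff _).2 ⟨_, (hctr _).symm⟩⟩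
  · rintro ⟨v, hvG, hv⟩
    obtain ⟨k, rfl⟩ := (I'.not_isULeaf_iff v).1 hv
    rw [← hctr] at hvG
    have := MixingRep.eq_group_of_ctr_mem (hg ▸ hG) hvG
    rw [this, hX.group_eq hF]
    exact ⟨_, M.indexingSelf.rep.ctr_mem_group k, k.2⟩

end

theorem faithful_sameEdges_of_dogEquiv (hM : M.Faithful) (h : DOGEquiv M M') :
    M'.Faithful ∧ SameEdges M M' := by
  obtain ⟨I', hI⟩ := exists_indexing h.1
  have hF := M.indexingSelf.faithful_iff.1 hM
  have hX := exchanged_of_dogEquiv hI hF h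
  exact ⟨I'.faithful_iff.2 (hX.faithful hF), sameEdges_of_exchanged hI hF hX⟩

theorem dogEquiv_of_faithful (hM : M.Faithful) (h : SameMixing M M') (hM' : M'.Faithful) :
    DOGEquiv M M' := by
  obtain ⟨I', hI⟩ := exists_indexing h
  have hF := M.indexingSelf.faithful_iff.1 hM
  exact dogEquiv_of_exchanged hI h hF (hF.eq_or_assigned (I'.faithful_iff.1 hM'))

end SEMME

/-! ### Identification of an SEM-UR by reversal of the edges -/

namespace SEMUR

variable {H X : Type*}

section Reverse

variable (M : SEMUR H X)

/-- The SEM-ME obtained by reversing all edges. With the observed variables of the SEM-UR as observed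
variables, its u-leaves are exactly the latent roots. -/
def reverse [Fintype H] [Fintype X] : SEMME (H ⊕ X) (Set.range Sum.inr) where
  coef := M.coef.transpose
  causalOrder := by
    obtain ⟨o, hinj, ho⟩ := M.causalOrder
    have hle : ∀ x, o x ≤ Finset.univ.sup o := fun x => Finset.le_sup (Finset.mem_univ x)
    refine ⟨Sum.elim (fun h => Finset.univ.sup o + 1 + Fintype.equivFin H h)
      (fun x => Finset.univ.sup o - o x), ?_, ?_⟩
    · rintro (h | x) (h' | x') e
      · simp only [Sum.elim_inl] at e
        rw [(Fintype.equivFin H).injective (a₁ := h) (a₂ := h') (Fin.ext (by omega))]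
      · simp only [Sum.elim_inl, Sum.elim_inr] at e
        omega
      · simp only [Sum.elim_inl, Sum.elim_inr] at e
        omega
      · simp only [Sum.elim_inr] at e
        have := hle x
        have := hle x'
        rw [hinj (a₁ := x) (a₂ := x') (by omega)]
    · rintro (h | x) (h' | x') e
      · exact absurd rfl e
      · simp only [Sum.elim_inl, Sum.elim_inr]
        omega
      · exact absurd rfl e
      · have h1 : o x < o x' := ho x' x e
        have := hle x'
        simp only [Sum.elim_inr]
        omega

variable [Fintype H] [Fintype X]

theorem isULeaf_reverse (v : H ⊕ X) : M.reverse.IsULeaf v ↔ IsLatent v := by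
  rcases v with h | x
  · simp only [IsLatent, Sum.isLeft_inl, iff_true]
    refine ⟨by simp, ?_⟩
    ext w
    simp [SEMME.Ch, reverse, coef]
    rcases w with w | w <;> simp
  · simp [IsLatent, SEMME.IsULeaf]

theorem De_eq (v : H ⊕ X) : M.De v = M.reverse.An v := by
  ext w
  exact Relation.transGen_swap.symm

theorem assigned_reverse (i l : H ⊕ X) : M.reverse.Assigned i l ↔ M.Assigned i l := by
  unfold SEMME.Assigned Assigned
  rw [isULeaf_reverse]
  rfl

theorem DOG_reverse : M.reverse.DOG = M.DOG := by
  unfold SEMME.DOG DOG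
  simp only [isULeaf_reverse, assigned_reverse]

variable [DecidableEq H] [DecidableEq X]

theorem TE_reverse (u v : H ⊕ X) : M.reverse.TE u v = M.TE v u := by
  unfold SEMME.TE TE reverse
  simp only [← Matrix.transpose_pow]
  rfl

theorem TCvec_eq (T : Set (H ⊕ X)) (v : H ⊕ X) : M.TCvec T v = M.reverse.TEvec T v := by
  ext w
  exact (M.TE_reverse _ _).symm

theorem faithful_reverse : M.reverse.Faithful ↔ M.Faithful := by
  have hPoss : ∀ v, M.PossCh v = M.reverse.PossPa v := by
    intro v
    ext u
    simp only [PossCh, SEMME.PossPa, De_eq, isULeaf_reverse]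
    rfl
  refine and_congr ?_ (and_congr ?_ ?_)
  · unfold SEMME.FaithfulA FaithfulA
    rw [forall_comm]
    simp only [De_eq, TE_reverse]
  · unfold SEMME.FaithfulB1 FaithfulB1
    refine forall₂_congr fun v S => ?_
    simp only [hPoss, isULeaf_reverse, funext (M.TCvec_eq _)]
    rw [← De_eq]
    rfl
  · unfold SEMME.FaithfulB2 FaithfulB2
    simp only [hPoss, isULeaf_reverse, funext (M.TCvec_eq _)]
    refine forall₂_congr fun i _ => forall₂_congr fun j _ => ?_
    rw [← De_eq]
    rfl

theorem coef_pow_card : M.coef ^ Fintype.card (H ⊕ X) = 0 := by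
  have h := M.reverse.coef_pow_card
  have h' : M.reverse.coef = M.coef.transpose := rfl
  rw [h', ← Matrix.transpose_pow] at h
  exact Matrix.transpose_injective h

theorem TE_eq (u v : H ⊕ X) :
    M.TE u v = ∑ w, M.coef v w * M.TE u w + if v = u then 1 else 0 := by
  have h := congrFun (congrFun (Matrix.geom_sum_eq_mul_add_one M.coef_pow_card) v) u
  rw [Matrix.add_apply, Matrix.mul_apply, Matrix.one_apply] at h
  simpa only [TE, Matrix.sum_apply] using h

theorem mixing_eq_TE (x : X) (v : H ⊕ X) : M.mixing x v = M.TE v (Sum.inr x) := by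
  have hlatent : ∀ (h : H) (u : H ⊕ X), M.TE u (Sum.inl h) = if Sum.inl h = u then 1 else 0 := by
    intro h u
    rw [TE_eq]
    simp [coef]
  have hinv : (1 - M.A) * (Matrix.of fun x y => M.TE (Sum.inr y) (Sum.inr x)) = 1 := by
    ext x y
    rw [Matrix.sub_mul, one_mul, Matrix.sub_apply, Matrix.mul_apply, Matrix.one_apply,
      Matrix.of_apply, M.TE_eq, Fintype.sum_sum_type]
    simp [coef, hlatent]
  have hB : (1 - M.A) * (Matrix.of fun x h => M.TE (Sum.inl h) (Sum.inr x)) = M.B := by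
    ext x h
    rw [Matrix.sub_mul, Matrix.one_mul, Matrix.sub_apply, Matrix.mul_apply,
      Matrix.of_apply, M.TE_eq, Fintype.sum_sum_type]
    simp [coef, hlatent]
  have hdet := Matrix.isUnit_det_of_right_inverse hinv
  rcases v with h | y
  · have : (1 - M.A)⁻¹ * M.B = Matrix.of fun x h => M.TE (Sum.inl h) (Sum.inr x) := by
      rw [← hB, Matrix.nonsing_inv_mul_cancel_left _ _ hdet]
    exact congrFun (congrFun this x) h
  · exact congrFun (congrFun (Matrix.inv_eq_right_inv hinv) x) y

end Reverse

variable [Fintype H] [Fintype X] [DecidableEq H] [DecidableEq X] {M M' : SEMUR H X}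

variable (M) in
/-- The rows of the transposed mixing matrix are labelled by the noise terms. -/
def indexingSelf : SEMME.Indexing M.reverse fun v x => M.mixing x v where
  row := Equiv.refl _
  col := Sum.inr
  col_inj := Sum.inr_injective
  not_isULeaf_iff v := by
    rw [isULeaf_reverse]
    cases v <;> simp [IsLatent]
  a _ := 1
  b _ := 1
  a_ne _ := one_ne_zero
  b_ne _ := one_ne_zero
  TE_eq v x := by rw [mixing_eq_TE, TE_reverse, one_mul, one_mul]; rfl

/-- The transposed mixing matrix of `M` as that of `M'`, whose noise terms are labelled by those
of `M`. -/
def indexingOfMatch (π : Equiv.Perm (H ⊕ X)) (s : H ⊕ X → ℝ) (hs : ∀ v, s v ≠ 0)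
    (h : ∀ x v, M'.mixing x (π v) = s v * M.mixing x v) :
    SEMME.Indexing M'.reverse fun v x => M.mixing x v where
  row := π
  col := Sum.inr
  col_inj := Sum.inr_injective
  not_isULeaf_iff v := by
    rw [isULeaf_reverse]
    cases v <;> simp [IsLatent]
  a := s
  b _ := 1
  a_ne := hs
  b_ne _ := one_ne_zero
  TE_eq v x := by rw [mul_one, ← h, mixing_eq_TE, TE_reverse]

theorem exists_indexing {π : Equiv.Perm (H ⊕ X)} (h : NoiseMatch M M' π) :
    ∃ I : SEMME.Indexing M'.reverse (fun v x => M.mixing x v),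
      I.row = π ∧ I.col = Sum.inr := by
  obtain ⟨s, hs, h⟩ := h
  exact ⟨indexingOfMatch π s hs h, rfl, rfl⟩

theorem DOG_eq_groups : M.DOG = M.indexingSelf.rep.groups := by
  rw [← DOG_reverse, M.indexingSelf.DOG_eq]
  exact (Set.image_congr fun G _ => Set.image_id G).trans (Set.image_id _)

section

variable {π : Equiv.Perm (H ⊕ X)}
  {I' : SEMME.Indexing M'.reverse fun v x => M.mixing x v} (hrow : I'.row = π)
  (hcol : I'.col = Sum.inr)
include hrow hcol

omit hcol in
theorem DOG_eq_image_groups : M'.DOG = (fun G => π '' G) '' I'.rep.groups := by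
  rw [← DOG_reverse, I'.DOG_eq, hrow]

theorem perm_ctr (x : X) : π (I'.rep.ctr x) = Sum.inr x := by
  rw [← hrow, I'.row_ctr, hcol]

theorem exchanged_of_dogMatch (h : DOGMatch M M' π) :
    MixingRep.Exchanged M.indexingSelf.rep I'.rep := by
  intro x
  obtain ⟨G', hG', h1, h2⟩ := h.2.2 x
  rw [← h.2.1, DOG_eq_groups] at hG'
  obtain ⟨G, hG, rfl⟩ := hG'
  rw [π.injective.mem_set_image] at h1
  rw [← perm_ctr hrow hcol x, π.injective.mem_set_image,
    MixingRep.eq_group_of_ctr_mem (k := x) hG h1] at h2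
  exact h2

theorem dogMatch_of_exchanged (hm : NoiseMatch M M' π) (hF : M.indexingSelf.rep.Faithful)
    (hX : MixingRep.Exchanged M.indexingSelf.rep I'.rep) : DOGMatch M M' π := by
  have hD := DOG_eq_image_groups hrow
  rw [hX.groups_eq hF] at hD
  refine ⟨hm, by rw [hD, DOG_eq_groups], fun x => ?_⟩
  refine ⟨π '' M.indexingSelf.rep.group x, ?_, ?_, ?_⟩
  · rw [hD]
    exact ⟨_, M.indexingSelf.rep.group_mem_groups x, rfl⟩
  · exact Set.mem_image_of_mem _ (M.indexingSelf.rep.ctr_mem_group x)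
  · rw [← perm_ctr hrow hcol x]
    exact Set.mem_image_of_mem _ (hX.ctr_mem_group' hF x)

theorem sameEdges_of_exchanged (hF : M.indexingSelf.rep.Faithful)
    (hX : MixingRep.Exchanged M.indexingSelf.rep I'.rep) : SameEdges M M' π := by
  have hp := hX.parallel hF
  let σ : H ⊕ X → H ⊕ X := MixingRep.swap M.indexingSelf.rep I'.rep
  have hσ : ∀ x, π (σ (Sum.inr x)) = Sum.inr x := by
    intro x
    exact (congrArg π (MixingRep.swap_ctr x)).trans (perm_ctr hrow hcol x)
  have hinj : Function.Injective fun v => π (σ v) :=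
    π.injective.comp hp.swap_involutive.injective
  have hex : ∀ h : H, ∃ h' : H, π (σ (Sum.inl h)) = Sum.inl h' := by
    intro h
    rcases e : π (σ (Sum.inl h)) with h' | x
    · exact ⟨h', rfl⟩
    · have := hinj (e.trans (hσ x).symm)
      cases this
  choose t ht using hex
  have ht_inj : Function.Injective t := by
    intro h h' e
    have := hinj ((ht h).trans ((congrArg Sum.inl e).trans (ht h').symm))
    exact Sum.inl_injective this
  have hPa : ∀ (x : X) (v : H ⊕ X), M.coef (Sum.inr x) v ≠ 0 ↔
      M'.coef (Sum.inr x) (π (σ v)) ≠ 0 := by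
    intro x v
    have h1 := M.indexingSelf.mem_Pa_iff (r := v) (k := x)
    have h2 := I'.mem_Pa_iff (r := σ v) (k := x)
    rw [hX.Pa_swap hF, hrow, hcol] at h2
    exact h1.symm.trans h2
  refine ⟨Equiv.ofBijective t (Finite.injective_iff_bijective.1 ht_inj), fun h => ?_,
    fun x h => ?_, fun x y => ?_⟩
  · obtain ⟨G, hG, h1, h2⟩ := hX.exists_group_swap hF (Sum.inl h)
    refine ⟨π '' G, ?_, Set.mem_image_of_mem _ h1, ?_⟩
    · rw [DOG_eq_image_groups hrow, hX.groups_eq hF]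
      exact ⟨G, hG, rfl⟩
    · rw [Equiv.ofBijective_apply, ← ht]
      exact Set.mem_image_of_mem _ h2
  · have := hPa x (Sum.inl h)
    rwa [ht] at this
  · have := hPa x (Sum.inr y)
    rwa [hσ] at this

end

theorem faithful_sameEdges_of_dogMatch (hM : M.Faithful) {π : Equiv.Perm (H ⊕ X)}
    (h : DOGMatch M M' π) : M'.Faithful ∧ SameEdges M M' π := by
  obtain ⟨I', hrow, hcol⟩ := exists_indexing h.1
  have hF := M.indexingSelf.faithful_iff.1 (M.faithful_reverse.2 hM)
  have hX := exchanged_of_dogMatch hrow hcol h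
  exact ⟨M'.faithful_reverse.1 (I'.faithful_iff.2 (hX.faithful hF)),
    sameEdges_of_exchanged hrow hcol hF hX⟩

theorem dogMatch_of_faithful (hM : M.Faithful) {π : Equiv.Perm (H ⊕ X)}
    (h : NoiseMatch M M' π) (hM' : M'.Faithful) : DOGMatch M M' π := by
  obtain ⟨I', hrow, hcol⟩ := exists_indexing h
  have hF := M.indexingSelf.faithful_iff.1 (M.faithful_reverse.2 hM)
  have hF' := I'.faithful_iff.1 (M'.faithful_reverse.2 hM')
  exact dogMatch_of_exchanged hrow hcol h hF (hF.eq_or_assigned hF')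

end SEMUR

end

theorem theorem3 :
    (∀ {V : Type*} [Fintype V] [DecidableEq V] {Y : Set V} (M : SEMME V Y), M.Faithful →
      (∀ M' : SEMME V Y, SEMME.DOGEquiv M M' →
        SEMME.SameMixing M M' ∧ M'.Faithful ∧ SEMME.SameEdges M M') ∧
      (∀ M' : SEMME V Y, SEMME.SameMixing M M' → ¬ SEMME.DOGEquiv M M' → ¬ M'.Faithful)) ∧
    (∀ {H X : Type*} [Fintype H] [DecidableEq H] [Fintype X] [DecidableEq X] (M : SEMUR H X),
      M.Faithful →
      (∀ M' : SEMUR H X, SEMUR.DOGEquiv M M' →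
        SEMUR.SameMixing M M' ∧ M'.Faithful ∧
          ∀ π, SEMUR.DOGMatch M M' π → SEMUR.SameEdges M M' π) ∧
      (∀ M' : SEMUR H X, SEMUR.SameMixing M M' → ¬ SEMUR.DOGEquiv M M' → ¬ M'.Faithful)) := by
  refine ⟨fun M hM => ⟨fun M' h => ?_, fun M' h hne hM' => ?_⟩,
    fun M hM => ⟨fun M' h => ?_, fun M' h hne hM' => ?_⟩⟩
  · exact ⟨h.1, SEMME.faithful_sameEdges_of_dogEquiv hM h⟩
  · exact hne (SEMME.dogEquiv_of_faithful hM h hM')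
  · obtain ⟨π, hπ⟩ := h
    exact ⟨⟨π, hπ.1⟩, (SEMUR.faithful_sameEdges_of_dogMatch hM hπ).1,
      fun π' hπ' => (SEMUR.faithful_sameEdges_of_dogMatch hM hπ').2⟩
  · obtain ⟨π, hπ⟩ := h
    exact hne ⟨π, SEMUR.dogMatch_of_faithful hM hπ hM'⟩
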